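/- Let $X$ be an integral noetherian scheme of dimension $2$ with function field $K$, and assume that the normalization of $X$ in $K$ is finite over $X$ (for example, $X$ Japanese). An order over $X$ in a finite-dimensional central simple $K$-algebra $A$ is a coherent sheaf of $\mathcal{O}_X$-subalgebras $\Lambda$ of the constant sheaf $A$ such that $K\cdot\Lambda=A$; it is maximal if it is not properly contained in another order over $X$ in $A$. The Brauer class of $A$ is called unramified if it lies in the image of $\mathrm{Br}(X)\to\mathrm{Br}(K)$, that is, if $A$ is Brauer equivalent to the generic fibre of an Azumaya algebra over $X$. Then $X$ is regular if and only if every maximal order over $X$ in a central simple $K$-algebra with unramified Brauer class is Azumaya. -/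

import Mathlib

open AlgebraicGeometry

universe u

noncomputable section

/-- A scheme is regular if all of its local rings are regular local rings. -/
def IsRegularScheme (X : Scheme.{u}) : Prop :=
  ∀ x : X, IsRegularLocalRing (X.presheaf.stalk x)

/-- The normalization of the integral scheme `X` (in its function field `K`) is finite over `X`:
for every nonempty affine open `U`, the integral closure of `Γ(X, U)` in `K` is a finitely
generated `Γ(X, U)`-module. Every Japanese scheme has this property, and so does every
normal one. -/
def HasFiniteNormalization (X : Scheme.{u}) [IsIntegral X] : Prop :=
  ∀ (U : X.Opens) [Nonempty U], IsAffineOpen U →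
    Module.Finite Γ(X, U) (integralClosure Γ(X, U) X.functionField)

/-- An order over the integral (locally noetherian) scheme `X` in an algebra `A` over the function
field `K` of `X`: a coherent sheaf of `𝒪_X`-subalgebras `Λ` of the constant sheaf `A` such that
`K · Λ = A`. Since `X` is irreducible, the sections of the constant sheaf over a nonempty open set
are just the elements of `A`, and all the restriction maps between them are the identity. -/
@[ext]
structure SchemeOrder (X : Scheme.{u}) [IsIntegral X] (A : Type u) [Ring A]
    [Algebra X.functionField A] where
  /-- The ring of sections over a nonempty open set. -/
  sections (U : X.Opens) [Nonempty U] : Subring A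
  /-- `Λ` is a subpresheaf of the constant sheaf. -/
  sections_anti {U V : X.Opens} [Nonempty U] [Nonempty V] (h : V ≤ U) : sections U ≤ sections V
  /-- `Λ` is a sheaf. -/
  mem_of_locally {U : X.Opens} [Nonempty U] {a : A}
    (h : ∀ x ∈ U, ∃ (V : X.Opens) (_ : Nonempty V), x ∈ V ∧ V ≤ U ∧ a ∈ sections V) :
    a ∈ sections U
  /-- `Λ` contains `𝒪_X`. -/
  germ_mem {U : X.Opens} [Nonempty U] (s : Γ(X, U)) :
    algebraMap X.functionField A (X.germToFunctionField U s) ∈ sections U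
  /-- `Λ` is quasi-coherent: for `U` affine and `f` a nonzero function on `U`, the sections over
  `D(f)` are those of the localization `Λ(U)_f`. -/
  exists_pow_mul_mem {U : X.Opens} [Nonempty U] (hU : IsAffineOpen U) (f : Γ(X, U))
    [Nonempty (X.basicOpen f)] {a : A} (ha : a ∈ sections (X.basicOpen f)) :
    ∃ n : ℕ, algebraMap X.functionField A (X.germToFunctionField U f) ^ n * a ∈ sections U
  /-- `Λ` is of finite type: for `U` affine, `Λ(U)` is generated as a `Γ(X, U)`-module by
  a finite set. -/
  exists_generators {U : X.Opens} [Nonempty U] (hU : IsAffineOpen U) :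
    ∃ S : Finset A, ∀ a : A, a ∈ sections U ↔
      ∃ c : A → Γ(X, U),
        a = ∑ s ∈ S, algebraMap X.functionField A (X.germToFunctionField U (c s)) * s
  /-- `Λ` spans `A` over `K`. -/
  span_eq_top {U : X.Opens} [Nonempty U] (hU : IsAffineOpen U) :
    Submodule.span X.functionField (sections U : Set A) = ⊤

namespace SchemeOrder

variable {X : Scheme.{u}} [IsIntegral X] {A : Type u} [Ring A] [Algebra X.functionField A]

/-- Orders in `A` are ordered by inclusion. -/
instance : PartialOrder (SchemeOrder X A) where
  le Λ Λ' := ∀ (U : X.Opens) [Nonempty U], Λ.sections U ≤ Λ'.sections U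
  le_refl _ _ _ := le_rfl
  le_trans _ _ _ h h' U _ := (h U).trans (h' U)
  le_antisymm Λ Λ' h h' := by
    ext U hU a
    exact ⟨fun ha => h U ha, fun ha => h' U ha⟩

/-- The structure map `Γ(X, U) → Λ(U)`. -/
def structureMap (Λ : SchemeOrder X A) (U : X.Opens) [Nonempty U] :
    Γ(X, U) →+* Λ.sections U :=
  ((algebraMap X.functionField A).comp (X.germToFunctionField U).hom).codRestrict
    (Λ.sections U) Λ.germ_mem

instance (Λ : SchemeOrder X A) (U : X.Opens) [Nonempty U] :
    Algebra Γ(X, U) (Λ.sections U) :=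
  (Λ.structureMap U).toAlgebra' fun c a =>
    Subtype.ext (Algebra.commutes (X.germToFunctionField U c : X.functionField) (a : A))

/-- An order `Λ` over `X` is maximal if it is not properly contained in another order over `X` in
the same algebra. -/
def IsMaximal (Λ : SchemeOrder X A) : Prop :=
  IsMax Λ

/-- An order `Λ` over `X` is Azumaya if it is a sheaf of Azumaya algebras over `X`, that is, if
`Λ(U)` is an Azumaya algebra over `Γ(X, U)` for every nonempty affine open `U`. -/
def IsAzumaya (Λ : SchemeOrder X A) : Prop :=
  ∀ (U : X.Opens) [Nonempty U], IsAffineOpen U → _root_.IsAzumaya Γ(X, U) (Λ.sections U)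

end SchemeOrder

/-- The Brauer class of the central simple `K`-algebra `A` is unramified over `X`, i.e. it lies in
the image of `Br(X) → Br(K)`: there is an Azumaya algebra over `X` whose generic fibre is Brauer
equivalent to `A`. (An Azumaya algebra over the integral scheme `X` is locally free, so it is a
subsheaf of the constant sheaf given by its generic fibre `B`, and thus an order over `X`
in `B`.) -/
def HasUnramifiedBrauerClass (X : Scheme.{u}) [IsIntegral X]
    (A : CSA.{u, u} X.functionField) : Prop :=
  ∃ (B : CSA.{u, u} X.functionField) (Λ : SchemeOrder X B),
    Λ.IsAzumaya ∧ IsBrauerEquivalent A B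

end

/-!
The proof compares orders with lattices, that is, with coherent subsheaves of a constant sheaf
which span it over the function field `K`. On a nonempty affine open set everything takes place
over its ring of functions, viewed as a subring of `K` (`AffinePatch.functions`). A `LatticeSheaf`
records the modules of sections over the affine open sets; `LatticeSheaf.toOrder` and
`LatticeSheaf.ofOrder` translate between orders and lattices which are rings. The basic
construction is `LatticeSheaf.colon`: for a bilinear map `β` and lattices `L₂`, `L₃`, the vectors
`v` such that `β v` maps `L₂` to `L₃` form a lattice again.

Regular implies Azumaya. Let `Λ` be a maximal order in `A`, and let `Λ'` be an Azumaya order in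
`B`, where `Mₙ(A) ≅ Mₘ(B)`. Let `Γ` be the order in `Mₙ(A)` corresponding to `Mₘ(Λ')`. The row
vectors `v` with `w v ∈ Γ` for all column vectors `w` over `Λ` form a `Λ`-`Γ`-bimodule `N`
(`connecting`). Its left order contains `Λ`, hence is equal to `Λ` by maximality, and so `Λ` is the
commutant of `Γ` in the endomorphism ring of the `𝒪`-module `N`. As a colon module, `N` is
saturated in a power of `Γ`. Over a regular ring of dimension at most two this makes it locally
free (`Module.projective_of_saturated`, an argument with Koszul relations), and the commutant of an
Azumaya algebra acting on a faithful projective module is Azumaya (`isAzumaya_commutant`).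

Azumaya implies regular. The normalization of `X` is a maximal order in `K`, so it is Azumaya by
assumption. A commutative Azumaya algebra is trivial, hence `X` is normal. Let `a₁, …, aₙ` be
functions with `a₁ ≠ 0`, and let `N` be the lattice of all `v ∈ 𝒪ⁿ` with `∑ vᵢ aᵢ / a₁ ∈ 𝒪`, where
the sum is over `i ≠ 1` (`relationLattice`). The first unit vector spans a direct factor of `N`.
Therefore, on a normal scheme, `End(N)` is a maximal order in `Mₙ(K)`: elements of a larger order
give rise to multiples `t e₁₁` in that order, whose coefficients `t` are integral. By assumption,
`End(N)` is Azumaya, thus locally free, and its direct factors `N` and the module of relations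
between the `aᵢ` are locally free as well. Applied to generators of the maximal ideal of a local
ring of `X` this shows that the residue field has a free resolution of length at most two. For a
normal local ring of dimension at most two it follows that the ring is regular
(`IsRegularLocalRing.of_projective_relations`): in dimension two, the maximal ideal is associated
to a regular sequence `x, y`, and comparing the resolution with the Koszul relations of `x, y`
bounds the number of generators of the maximal ideal.
-/

/-! ### Azumaya algebras and commutants -/

section

open scoped TensorProduct
open MulOpposite

/-- A finite projective module has a finite dual basis. -/
lemma Module.Finite.exists_dual_basis (R M : Type*) [CommRing R] [AddCommGroup M] [Module R M]
    [Module.Finite R M] [Module.Projective R M] :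
    ∃ (n : ℕ) (b : Fin n → M) (f : Fin n → M →ₗ[R] R), ∀ x, ∑ j, f j x • b j = x := by
  obtain ⟨n, π, s, hs, -, h⟩ := Module.Finite.exists_comp_eq_id_of_projective R M
  refine ⟨n, fun j => π (Pi.single j 1), fun j => LinearMap.proj j ∘ₗ s, fun x => ?_⟩
  have := LinearMap.congr_fun h x
  simp only [LinearMap.comp_apply, LinearMap.id_apply] at this
  conv_rhs => rw [← this, pi_eq_sum_univ' (s x)]
  simp

section Centralizer

variable {R Γ N : Type*} [CommRing R] [Ring Γ] [Algebra R Γ] [AddCommGroup N] [Module R N]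

/-- For a right action `i` of `Γ` on `N`, the action of `Γ ⊗ Γᵐᵒᵖ` on the endomorphisms of the
`R`-module `N`: the tensor `a ⊗ b` sends `g` to `i b * g * i a`, just as it sends `x : Γ` to
`a * x * b`. -/
noncomputable def endAction (i : Γᵐᵒᵖ →ₐ[R] Module.End R N) :
    Γ ⊗[R] Γᵐᵒᵖ →ₗ[R] Module.End R N →ₗ[R] Module.End R N :=
  TensorProduct.lift <| LinearMap.mk₂ R
    (fun a b => LinearMap.mulLeft R (i b) ∘ₗ LinearMap.mulRight R (i (op a)))
    (fun a a' b => by ext g : 1; simp [mul_add])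
    (fun c a b => by ext g : 1; simp)
    (fun a b b' => by ext g : 1; simp [add_mul])
    (fun c a b => by ext g : 1; simp)

variable (i : Γᵐᵒᵖ →ₐ[R] Module.End R N)

@[simp]
lemma endAction_tmul (a : Γ) (b : Γᵐᵒᵖ) (g : Module.End R N) :
    endAction i (a ⊗ₜ b) g = i b * (g * i (op a)) := by
  simp [endAction]

lemma endAction_one_tmul_mul (c : Γ) (z : Γ ⊗[R] Γᵐᵒᵖ) (g : Module.End R N) :
    endAction i ((1 ⊗ₜ op c) * z) g = i (op c) * endAction i z g := by
  induction z with
  | zero => simp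
  | tmul a b => simp [mul_assoc]
  | add x y hx hy => simp [mul_add, hx, hy]

lemma endAction_tmul_one_mul (c : Γ) (z : Γ ⊗[R] Γᵐᵒᵖ) (g : Module.End R N) :
    endAction i ((c ⊗ₜ 1) * z) g = endAction i z g * i (op c) := by
  induction z with
  | zero => simp
  | tmul a b => simp [mul_assoc]
  | add x y hx hy => simp [mul_add, add_mul, hx, hy]

lemma endAction_range (z : Γ ⊗[R] Γᵐᵒᵖ) (c : Γ) :
    endAction i z (i (op c)) = i (op (AlgHom.mulLeftRight R Γ z c)) := by
  induction z with
  | zero => simp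
  | tmul a b => simp [← map_mul, mul_assoc]
  | add x y hx hy => simp [hx, hy]

/-- The endomorphisms of `N` that commute with the right action `i` of `Γ`. -/
abbrev commutant : Subalgebra R (Module.End R N) := Subalgebra.centralizer R (i.range : Set _)

lemma mem_commutant {g : Module.End R N} :
    g ∈ commutant i ↔ ∀ c, i (op c) * g = g * i (op c) := by
  simp only [commutant, Subalgebra.mem_centralizer_iff]
  constructor
  · exact fun h c => h _ ⟨op c, rfl⟩
  · rintro h _ ⟨c, rfl⟩
    exact h c.unop

lemma endAction_mul_left {p : Module.End R N} (hp : p ∈ commutant i) (z : Γ ⊗[R] Γᵐᵒᵖ)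
    (g : Module.End R N) : endAction i z (p * g) = p * endAction i z g := by
  induction z with
  | zero => simp
  | tmul a b =>
    have := (mem_commutant i).1 hp b.unop
    simp only [op_unop] at this
    simp only [endAction_tmul, ← mul_assoc, this]
  | add x y hx hy => simp [mul_add, hx, hy]

variable [IsAzumaya R Γ]

/-- The element of `Γ ⊗ Γᵐᵒᵖ` that acts on the Azumaya algebra `Γ` as a linear form. -/
noncomputable def formTensor (t : Γ →ₗ[R] R) : Γ ⊗[R] Γᵐᵒᵖ :=
  (Equiv.ofBijective _ (IsAzumaya.bij (R := R) (A := Γ))).symm (Algebra.linearMap R Γ ∘ₗ t)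

lemma mulLeftRight_formTensor (t : Γ →ₗ[R] R) :
    AlgHom.mulLeftRight R Γ (formTensor t) = Algebra.linearMap R Γ ∘ₗ t :=
  (Equiv.ofBijective _ (IsAzumaya.bij (R := R) (A := Γ))).apply_symm_apply _

lemma mulLeftRight_formTensor_apply (t : Γ →ₗ[R] R) (x : Γ) :
    AlgHom.mulLeftRight R Γ (formTensor t) x = algebraMap R Γ (t x) := by
  rw [mulLeftRight_formTensor]; rfl

lemma endAction_formTensor_mem (t : Γ →ₗ[R] R) (g : Module.End R N) :
    endAction i (formTensor t) g ∈ commutant i := by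
  refine (mem_commutant i).2 fun c => ?_
  rw [← endAction_one_tmul_mul, ← endAction_tmul_one_mul]
  congr 2
  -- elements of `Γ ⊗ Γᵐᵒᵖ` are determined by their action on `Γ`
  apply (IsAzumaya.bij (R := R) (A := Γ)).1
  ext x
  simp [mulLeftRight_formTensor_apply, Algebra.commutes]

lemma endAction_formTensor_of_mem (t : Γ →ₗ[R] R) {g : Module.End R N} (hg : g ∈ commutant i) :
    endAction i (formTensor t) g = t 1 • g := by
  have h := endAction_mul_left i hg (formTensor t) 1
  rw [mul_one] at h
  rw [h, ← map_one i, ← op_one, endAction_range, mulLeftRight_formTensor_apply]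
  rw [show op (algebraMap R Γ (t 1)) = algebraMap R Γᵐᵒᵖ (t 1) from rfl, AlgHom.commutes,
    ← Algebra.commutes, ← Algebra.smul_def]

/-- An Azumaya algebra contains its base ring as a direct summand. -/
lemma IsAzumaya.exists_form_one (R Γ : Type*) [CommRing R] [Ring Γ] [Algebra R Γ] [IsAzumaya R Γ] :
    ∃ t : Γ →ₗ[R] R, t 1 = 1 := by
  obtain ⟨n, b, f, hf⟩ := Module.Finite.exists_dual_basis R Γ
  let J : Ideal R := LinearMap.range (LinearMap.applyₗ (1 : Γ) : (Γ →ₗ[R] R) →ₗ[R] R)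
  have hJ : ∀ t : Γ →ₗ[R] R, t 1 ∈ J := fun t => ⟨t, rfl⟩
  suffices J = ⊤ by
    have h1 : (1 : R) ∈ J := this ▸ Submodule.mem_top
    exact h1
  have htop : (⊤ : Submodule R Γ) ≤ J • ⊤ := by
    intro x _
    rw [← one_mul x, ← hf 1, Finset.sum_mul]
    refine Submodule.sum_mem _ fun j _ => ?_
    rw [smul_mul_assoc]
    exact Submodule.smul_mem_smul (hJ _) trivial
  obtain ⟨r, hr, hr'⟩ := Submodule.exists_sub_one_mem_and_smul_eq_zero_of_fg_of_le_smul J ⊤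
    Module.Finite.fg_top htop
  have : r = 0 := FaithfulSMul.eq_of_smul_eq_smul (M := R) (α := Γ) fun x => by
    rw [hr' x trivial, zero_smul]
  rw [this, zero_sub] at hr
  exact (Ideal.eq_top_iff_one _).2 (by simpa using J.neg_mem hr)

/-- The averaging operator attached to a linear form `t` on the Azumaya algebra `Γ`: it maps the
endomorphisms of `N` to those that commute with `Γ`. -/
noncomputable def commutantProj (t : Γ →ₗ[R] R) : Module.End R N →ₗ[R] commutant i :=
  (endAction i (formTensor t)).codRestrict (Subalgebra.toSubmodule (commutant i))
    (endAction_formTensor_mem i t)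

@[simp]
lemma coe_commutantProj (t : Γ →ₗ[R] R) (g : Module.End R N) :
    (commutantProj i t g : Module.End R N) = endAction i (formTensor t) g := rfl

lemma commutantProj_coe {t : Γ →ₗ[R] R} (ht : t 1 = 1) (g : commutant i) :
    commutantProj i t g = g := by
  ext1
  rw [coe_commutantProj, endAction_formTensor_of_mem i t g.2, ht, one_smul]

/-- `Module.End R N` is generated by the commutant of `Γ` as a module over the image of `Γ`. -/
lemma sum_commutantProj_mul {n : ℕ} {c : Fin n → Γ} {f : Fin n → Γ →ₗ[R] R}
    (hf : ∀ x, ∑ j, f j x • c j = x) (g : Module.End R N) :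
    ∑ s, (commutantProj i (f s) g : Module.End R N) * i (op (c s)) = g := by
  have h1 : ∑ s, (c s ⊗ₜ[R] (1 : Γᵐᵒᵖ)) * formTensor (f s) = 1 := by
    apply (IsAzumaya.bij (R := R) (A := Γ)).1
    ext x
    conv_rhs => rw [map_one, Module.End.one_apply, ← hf x]
    simp [mulLeftRight_formTensor_apply, ← Algebra.commutes, Algebra.smul_def]
  have h2 : endAction i 1 g = g := by simp [Algebra.TensorProduct.one_def]
  conv_rhs => rw [← h2, ← h1]
  simp [endAction_tmul_one_mul]

/-- If `p` and `q` are written as combinations of elements of the commutant with coefficients in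
`Γ`, the map `g ↦ p * g * q` becomes, after averaging, a sum of two-sided multiplications on the
commutant. -/
lemma commutantProj_mul_mul_mem_range (t : Γ →ₗ[R] R) (p q : Module.End R N) :
    commutantProj i t ∘ₗ LinearMap.mulLeft R p ∘ₗ LinearMap.mulRight R q ∘ₗ
      (commutant i).val.toLinearMap ∈
        LinearMap.range (AlgHom.mulLeftRight R (commutant i)).toLinearMap := by
  obtain ⟨n, c, f, hf⟩ := Module.Finite.exists_dual_basis R Γ
  refine ⟨∑ s, ∑ s', t (c s' * c s) • (commutantProj i (f s) p ⊗ₜ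
    op (commutantProj i (f s') q)), ?_⟩
  ext g : 2
  have key : ∀ s s', (commutantProj i (f s) p : Module.End R N) * i (op (c s)) *
      (g * (commutantProj i (f s') q * i (op (c s')))) =
      ((commutantProj i (f s) p * g * commutantProj i (f s') q : commutant i) : Module.End R N) *
        i (op (c s' * c s)) := by
    intro s s'
    have h1 := (mem_commutant i).1 (g * commutantProj i (f s') q).2 (c s)
    push_cast at h1 ⊢
    rw [op_mul, map_mul]
    calc _ = (commutantProj i (f s) p : Module.End R N) *
          (i (op (c s)) * (g * (commutantProj i (f s') q : Module.End R N))) *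
            i (op (c s')) := by simp only [mul_assoc]
      _ = _ := by rw [h1]; simp only [mul_assoc]
  have key2 : ∀ s s', endAction i (formTensor t) ((commutantProj i (f s) p : Module.End R N) *
      i (op (c s)) * (g * (commutantProj i (f s') q * i (op (c s'))))) =
      t (c s' * c s) •
        ((commutantProj i (f s) p * g * commutantProj i (f s') q : commutant i) :
          Module.End R N) := by
    intro s s'
    rw [key, endAction_mul_left _ (SetLike.coe_mem _), endAction_range,
      mulLeftRight_formTensor_apply,
      show op (algebraMap R Γ (t (c s' * c s))) = algebraMap R Γᵐᵒᵖ (t (c s' * c s)) from rfl,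
      AlgHom.commutes, ← Algebra.commutes, ← Algebra.smul_def]
  have h3 : p * ((g : Module.End R N) * q) = ∑ s, ∑ s', (commutantProj i (f s) p : Module.End R N) *
      i (op (c s)) * (g * (commutantProj i (f s') q * i (op (c s')))) := by
    simp_rw [← Finset.mul_sum, sum_commutantProj_mul i hf q, ← Finset.sum_mul,
      sum_commutantProj_mul i hf p]
  have h4 : endAction i (formTensor t) (p * ((g : Module.End R N) * q)) =
      ∑ s, ∑ s', t (c s' * c s) • ((commutantProj i (f s) p * g * commutantProj i (f s') q :
        commutant i) : Module.End R N) := by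
    rw [h3]
    simp only [map_sum, key2]
  refine Eq.trans ?_ h4.symm
  simp [-coe_commutantProj, LinearMap.sum_apply]

variable [Module.Finite R N] [Module.Projective R N]

/-- The endomorphisms of `N` form a retract of a finite power of `N`. -/
lemma Module.End.exists_retract (R N : Type*) [CommRing R] [AddCommGroup N] [Module R N]
    [Module.Finite R N] [Module.Projective R N] :
    ∃ (n : ℕ) (s : Module.End R N →ₗ[R] Fin n → N) (r : (Fin n → N) →ₗ[R] Module.End R N),
      r ∘ₗ s = LinearMap.id := by
  obtain ⟨n, b, f, hf⟩ := Module.Finite.exists_dual_basis R N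
  refine ⟨n, LinearMap.pi fun j => LinearMap.applyₗ (b j),
    ∑ j, LinearMap.smulRightₗ (f j) ∘ₗ LinearMap.proj j, ?_⟩
  ext g v
  conv_rhs => rw [LinearMap.id_apply, ← hf v, map_sum]
  simp [LinearMap.sum_apply]

instance Module.End.finite_of_projective : Module.Finite R (Module.End R N) := by
  obtain ⟨n, s, r, h⟩ := Module.End.exists_retract R N
  exact Module.Finite.of_surjective r fun g => ⟨s g, LinearMap.congr_fun h g⟩

instance Module.End.projective_of_projective : Module.Projective R (Module.End R N) := by
  obtain ⟨n, s, r, h⟩ := Module.End.exists_retract R N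
  have : Module.Projective R (Fin n → N) :=
    .of_equiv (DFinsupp.linearEquivFunOnFintype (R := R) (M := fun _ : Fin n => N))
  exact Module.Projective.of_split s r h

instance finite_commutant : Module.Finite R (commutant i) := by
  obtain ⟨t, ht⟩ := IsAzumaya.exists_form_one R Γ
  exact Module.Finite.of_surjective (commutantProj i t) fun g => ⟨g, commutantProj_coe i ht g⟩

instance projective_commutant : Module.Projective R (commutant i) := by
  obtain ⟨t, ht⟩ := IsAzumaya.exists_form_one R Γ
  exact Module.Projective.of_split (commutant i).val.toLinearMap (commutantProj i t)
    (LinearMap.ext fun g => commutantProj_coe i ht g)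

/-- Every endomorphism of the commutant is a sum of two-sided multiplications. It suffices to prove
this for linear forms; by the dual basis of `N` these are averages of sums of maps `g ↦ p * g * q`
with `p, q` in `Module.End R N`. -/
lemma mulLeftRight_commutant_surjective :
    Function.Surjective (AlgHom.mulLeftRight R (commutant i)) := by
  obtain ⟨t, ht⟩ := IsAzumaya.exists_form_one R Γ
  obtain ⟨n, b, f, hf⟩ := Module.Finite.exists_dual_basis R N
  obtain ⟨m, c, k, hk⟩ := Module.Finite.exists_dual_basis R (commutant i)
  -- linear forms, viewed as endomorphisms, are in the range
  have hform : ∀ F : commutant i →ₗ[R] R, Algebra.linearMap R (commutant i) ∘ₗ F ∈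
      LinearMap.range (AlgHom.mulLeftRight R (commutant i)).toLinearMap := by
    intro F
    have h : Algebra.linearMap R (commutant i) ∘ₗ F = ∑ x, ∑ y, ∑ z,
        F (commutantProj i t ((f x).smulRight (b y))) •
          (commutantProj i t ∘ₗ LinearMap.mulLeft R ((f y).smulRight (b z)) ∘ₗ
            LinearMap.mulRight R ((f z).smulRight (b x)) ∘ₗ
              (commutant i).val.toLinearMap) := by
      ext g : 1
      have hg : (g : Module.End R N) = ∑ x, ∑ y, f y (g.1 (b x)) • (f x).smulRight (b y) := by
        ext v
        conv_lhs => rw [← hf v, map_sum]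
        simp only [map_smul]
        refine Eq.trans ?_ (by simp [LinearMap.sum_apply]; rfl)
        refine Finset.sum_congr rfl fun x _ => ?_
        conv_lhs => rw [← hf (g.1 (b x)), Finset.smul_sum]
        exact Finset.sum_congr rfl fun y _ => smul_comm _ _ _
      have hFg : F g = ∑ x, ∑ y, f y (g.1 (b x)) *
          F (commutantProj i t ((f x).smulRight (b y))) := by
        conv_lhs => rw [← commutantProj_coe i ht g, hg]
        simp only [map_sum, map_smul, smul_eq_mul]
      have h1 : (F g) • (1 : Module.End R N) = ∑ x, ∑ y, ∑ z,
          F (commutantProj i t ((f x).smulRight (b y))) •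
            ((f y).smulRight (b z) * ((g : Module.End R N) * (f z).smulRight (b x))) := by
        ext v
        conv_lhs => rw [LinearMap.smul_apply, Module.End.one_apply, ← hf v, hFg]
        simp only [Finset.sum_smul, Finset.smul_sum, LinearMap.sum_apply]
        rw [Finset.sum_comm]
        refine Finset.sum_congr rfl fun x _ => ?_
        rw [Finset.sum_comm]
        refine Finset.sum_congr rfl fun y _ =>
          Finset.sum_congr rfl fun z _ => ?_
        simp only [LinearMap.smul_apply, Module.End.mul_apply, LinearMap.smulRight_apply, map_smul,
          smul_smul]
        congr 1
        ring
      have h2 := congrArg (commutantProj i t) h1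
      rw [map_smul, show (1 : Module.End R N) = ((1 : commutant i) : Module.End R N) from rfl,
        commutantProj_coe i ht] at h2
      simp only [LinearMap.comp_apply, Algebra.linearMap_apply, Algebra.algebraMap_eq_smul_one, h2]
      simp [LinearMap.sum_apply]
    rw [h]
    exact Submodule.sum_mem _ fun x _ => Submodule.sum_mem _ fun y _ =>
      Submodule.sum_mem _ fun z _ =>
        Submodule.smul_mem _ _ (commutantProj_mul_mul_mem_range i t _ _)
  intro φ
  choose z hz using fun j => hform (k j ∘ₗ φ)
  refine ⟨∑ j, (c j ⊗ₜ[R] (1 : (commutant i)ᵐᵒᵖ)) * z j, ?_⟩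
  refine LinearMap.ext fun g => ?_
  have hz' : ∀ j, AlgHom.mulLeftRight R (commutant i) (z j) g =
      algebraMap R (commutant i) (k j (φ g)) := fun j => LinearMap.congr_fun (hz j) g
  conv_rhs => rw [← hk (φ g)]
  simp only [map_sum, map_mul, LinearMap.sum_apply, Module.End.mul_apply, hz',
    AlgHom.mulLeftRight_apply, unop_one, mul_one, Algebra.smul_def]
  exact Finset.sum_congr rfl fun j _ => (Algebra.commutes _ _).symm

end Centralizer

lemma Module.rankAtStalk_end (R M : Type*) [CommRing R] [AddCommGroup M] [Module R M]
    [Module.Finite R M] [Module.Projective R M] :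
    Module.rankAtStalk (R := R) (Module.End R M) =
      Module.rankAtStalk (R := R) M * Module.rankAtStalk (R := R) M := by
  ext p
  have : Module.FinitePresentation R M := Module.finitePresentation_of_projective R M
  have : Module.Free (Localization.AtPrime p.asIdeal) (LocalizedModule p.asIdeal.primeCompl M) :=
    Module.free_of_flat_of_isLocalRing
  let e := (Module.FinitePresentation.linearEquivMapExtendScalars (M := M) (N := M)
    p.asIdeal.primeCompl).extendScalarsOfIsLocalization p.asIdeal.primeCompl
      (Localization.AtPrime p.asIdeal)
  exact e.finrank_eq.trans (Module.finrank_linearMap _ _ _ _)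

/-- A finite projective faithful algebra `A` is Azumaya as soon as every linear endomorphism of `A`
is a sum of maps `x ↦ a * x * b`: the surjection `A ⊗ Aᵐᵒᵖ → End A` is bijective because both
sides have the same rank. -/
lemma IsAzumaya.of_surjective {R A : Type*} [CommRing R] [Ring A] [Algebra R A] [Module.Finite R A]
    [Module.Projective R A] [FaithfulSMul R A]
    (h : Function.Surjective (AlgHom.mulLeftRight R A)) : IsAzumaya R A where
  bij := by
    have e : A ≃ₗ[R] Aᵐᵒᵖ := MulOpposite.opLinearEquiv R
    have : Module.Projective R Aᵐᵒᵖ := .of_equiv e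
    have : Module.Finite R Aᵐᵒᵖ := .equiv e
    refine Module.bijective_of_surjective_of_rankAtStalk_eq
      (φ := (AlgHom.mulLeftRight R A).toLinearMap) h fun m _ => ?_
    rw [Module.rankAtStalk_tensorProduct, Module.rankAtStalk_end,
      ← Module.rankAtStalk_eq_of_equiv e]

/-- The commutant of an Azumaya algebra in the endomorphism ring of a finite projective faithful
module is Azumaya. -/
theorem isAzumaya_commutant {R Γ N : Type*} [CommRing R] [Ring Γ] [Algebra R Γ] [AddCommGroup N]
    [Module R N] (i : Γᵐᵒᵖ →ₐ[R] Module.End R N) [IsAzumaya R Γ] [Module.Finite R N]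
    [Module.Projective R N] [FaithfulSMul R N] : IsAzumaya R (commutant i) := by
  have : FaithfulSMul R (commutant i) := by
    refine ⟨fun {r s} h => FaithfulSMul.eq_of_smul_eq_smul (M := R) (α := N) fun v => ?_⟩
    simpa using LinearMap.congr_fun (congrArg Subtype.val (h 1)) v
  exact .of_surjective (mulLeftRight_commutant_surjective i)

lemma isAzumaya_of_bijective_commutant {R Γ N Λ : Type*} [CommRing R] [Ring Γ] [Algebra R Γ]
    [AddCommGroup N] [Module R N] (i : Γᵐᵒᵖ →ₐ[R] Module.End R N) [IsAzumaya R Γ]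
    [Module.Finite R N] [Module.Projective R N] [FaithfulSMul R N] [Ring Λ] [Algebra R Λ]
    (f : Λ →ₐ[R] commutant i)
    (hf : Function.Bijective f) : IsAzumaya R Λ :=
  have := isAzumaya_commutant i
  .of_AlgEquiv _ _ _ (AlgEquiv.ofBijective f hf).symm

/-- Matrix algebras over an Azumaya algebra are Azumaya. -/
theorem IsAzumaya.matrix_of_isAzumaya {R A ι : Type*} [CommRing R] [Ring A] [Algebra R A]
    [Fintype ι] [DecidableEq ι] [Nonempty ι] [h : IsAzumaya R A] : IsAzumaya R (Matrix ι ι A) := by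
  have : Module.Projective R (Matrix ι ι A) :=
    .of_equiv ((DFinsupp.linearEquivFunOnFintype (R := R) (M := fun _ : ι => Π₀ _ : ι, A)).trans
      (LinearEquiv.piCongrRight fun _ => DFinsupp.linearEquivFunOnFintype))
  have : FaithfulSMul R (Matrix ι ι A) := by
    refine ⟨fun {r s} h => FaithfulSMul.eq_of_smul_eq_smul (M := R) (α := A) fun v => ?_⟩
    have i := Classical.arbitrary ι
    simpa using congrFun (congrFun (h (Matrix.of fun _ _ => v)) i) i
  have : Module.Finite R (Matrix ι ι A) := inferInstanceAs (Module.Finite R (ι → ι → A))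
  refine IsAzumaya.of_surjective fun φ => ?_
  choose z hz using fun i j k l => h.bij.2
    (Matrix.entryLinearMap R A i j ∘ₗ φ ∘ₗ Matrix.singleLinearMap R k l)
  -- `a ⊗ b` placed in the positions `(i, k)` and `(l, j)`
  let T (i j k l : ι) : A ⊗[R] Aᵐᵒᵖ →ₗ[R] Matrix ι ι A ⊗[R] (Matrix ι ι A)ᵐᵒᵖ :=
    TensorProduct.map (Matrix.singleLinearMap R i k) ((opLinearEquiv R).toLinearMap ∘ₗ
      Matrix.singleLinearMap R l j ∘ₗ (opLinearEquiv R).symm.toLinearMap)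
  have hT : ∀ i j k l y x, AlgHom.mulLeftRight R (Matrix ι ι A) (T i j k l y) x =
      Matrix.single i j (AlgHom.mulLeftRight R A y (x k l)) := by
    intro i j k l y x
    induction y with
    | zero => simp
    | tmul a b => simp [T, Matrix.single_mul_mul_single]
    | add y y' hy hy' => simp [hy, hy', Matrix.single_add]
  refine ⟨∑ i, ∑ j, ∑ k, ∑ l, T i j k l (z i j k l), LinearMap.ext fun x => ?_⟩
  have hx : ∀ i j, φ x i j = ∑ k, ∑ l, φ (Matrix.single k l (x k l)) i j := fun i j => by
    conv_lhs => rw [Matrix.matrix_eq_sum_single x]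
    simp only [map_sum, Matrix.sum_apply]
  conv_rhs => rw [Matrix.matrix_eq_sum_single (φ x)]
  simp only [map_sum, LinearMap.sum_apply, hx, hT, hz,
    ← Matrix.singleLinearMap_apply R]
  rfl

/-- The Azumaya property only depends on the image of the base ring. -/
theorem IsAzumaya.of_ringEquiv {R S A : Type*} [CommRing R] [CommRing S] [Ring A] [Algebra R A]
    [Algebra S A] (e : R ≃+* S) (he : ∀ r, algebraMap R A r = algebraMap S A (e r))
    [h : IsAzumaya R A] : IsAzumaya S A := by
  have hsmul : ∀ (r : R) (a : A), r • a = e r • a := fun r a => by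
    rw [Algebra.smul_def, Algebra.smul_def, he]
  let := RingHomInvPair.of_ringEquiv e
  let := RingHomInvPair.of_ringEquiv e.symm
  let E : A ≃ₛₗ[(e : R →+* S)] A := { AddEquiv.refl A with map_smul' := hsmul }
  have : Module.Projective S A := Module.Projective.of_equiv E
  have : Module.Finite S A := Module.Finite.of_surjective E.toLinearMap E.surjective
  have : FaithfulSMul S A := ⟨fun {s t} hst => by
    rw [← e.apply_symm_apply s, ← e.apply_symm_apply t]
    congr 1
    refine FaithfulSMul.eq_of_smul_eq_smul (M := R) (α := A) fun a => ?_
    rw [hsmul, hsmul, e.apply_symm_apply, e.apply_symm_apply, hst]⟩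
  have key : ∀ z : A ⊗[R] Aᵐᵒᵖ, ∃ z' : A ⊗[S] Aᵐᵒᵖ, ∀ x,
      AlgHom.mulLeftRight S A z' x = AlgHom.mulLeftRight R A z x := by
    intro z
    induction z with
    | zero => exact ⟨0, by simp⟩
    | tmul a b => exact ⟨a ⊗ₜ b, by simp⟩
    | add y y' hy hy' =>
      obtain ⟨z, hz⟩ := hy
      obtain ⟨z', hz'⟩ := hy'
      exact ⟨z + z', fun x => by simp [hz, hz']⟩
  refine IsAzumaya.of_surjective fun φ => ?_
  let φ' : Module.End R A :=
    { toFun := φ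
      map_add' := map_add φ
      map_smul' := fun r a => by simp [hsmul] }
  obtain ⟨z, hz⟩ := h.bij.2 φ'
  obtain ⟨z', hz'⟩ := key z
  exact ⟨z', LinearMap.ext fun x => by rw [hz', hz]; rfl⟩

/-- A commutative Azumaya algebra is trivial. -/
theorem IsAzumaya.algebraMap_surjective_of_comm {R A : Type*} [CommRing R] [CommRing A]
    [Algebra R A] [h : IsAzumaya R A] : Function.Surjective (algebraMap R A) := by
  rw [← Algebra.isEpi_iff_surjective_algebraMap_of_finite, Algebra.isEpi_iff_forall_one_tmul_eq]
  intro a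
  have h1 : (1 : A) ⊗ₜ[R] op a = a ⊗ₜ[R] op 1 := h.bij.1 <| LinearMap.ext fun x => by
    simp [mul_comm]
  simpa using congrArg (TensorProduct.map LinearMap.id (opLinearEquiv R).symm.toLinearMap) h1

lemma IsAzumaya.of_bijective_algebraMap {R A : Type*} [CommRing R] [Ring A] [Algebra R A]
    (h : Function.Bijective (algebraMap R A)) : IsAzumaya R A :=
  have := IsAzumaya.id R
  .of_AlgEquiv _ _ _ (AlgEquiv.ofBijective (Algebra.ofId R A) h)

end

/-! ### Projective modules and relations over local rings -/

section

open IsLocalRing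
open scoped TensorProduct

/-- In a domain, `x, y` is a regular sequence (not required to generate a proper ideal). -/
structure IsRegularPair {S : Type*} [CommRing S] (x y : S) : Prop where
  ne_zero : x ≠ 0
  dvd_of_dvd_mul : ∀ a, x ∣ y * a → x ∣ a

section Koszul

variable {S : Type*} [CommRing S]

lemma IsRegularPair.exists_of_add_eq_zero [IsDomain S] {x y : S} (h : IsRegularPair x y)
    {G : Type*} [AddCommGroup G] [Module S G] [Module.Free S G] {a b : G}
    (hab : x • a + y • b = 0) : ∃ w, a = y • w ∧ b = -(x • w) := by
  let e := Module.Free.chooseBasis S G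
  have hdvd : ∀ j, x ∣ e.repr b j := fun j => by
    refine h.dvd_of_dvd_mul _ ⟨-e.repr a j, ?_⟩
    have := congrArg (fun v => e.repr v j) hab
    simp only [map_add, map_smul, Finsupp.coe_add, Finsupp.coe_smul, Pi.add_apply, Pi.smul_apply,
      smul_eq_mul, map_zero, Finsupp.coe_zero, Pi.zero_apply] at this
    linear_combination this
  obtain ⟨w, hw⟩ : ∃ w, b = x • w := by
    choose c hc using hdvd
    refine ⟨∑ j ∈ (e.repr b).support, c j • e j, ?_⟩
    conv_lhs => rw [← e.linearCombination_repr b, Finsupp.linearCombination_apply, Finsupp.sum]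
    rw [Finset.smul_sum]
    refine Finset.sum_congr rfl fun j _ => ?_
    rw [smul_smul, ← hc]
  refine ⟨-w, smul_right_injective G h.ne_zero ?_, by rw [smul_neg, neg_neg, hw]⟩
  simp only [hw] at hab
  simp only [smul_neg]
  rw [smul_comm x y w, ← sub_eq_zero, sub_neg_eq_add, hab]

/-- If the maximal ideal of a local ring is generated by `x, y` and the Koszul relations are the
only relations between `x` and `y` on `M`, then `M` is free. -/
lemma Module.free_of_koszul [IsLocalRing S] {M : Type*} [AddCommGroup M] [Module S M]
    [Module.FinitePresentation S M] {x y : S} (hxy : maximalIdeal S = Ideal.span {x, y})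
    (H : ∀ a b : M, x • a + y • b = 0 → ∃ w, a = y • w ∧ b = -(x • w)) : Module.Free S M := by
  refine Module.free_of_maximalIdeal_rTensor_injective ?_
  have hx : x ∈ maximalIdeal S := hxy ▸ Ideal.subset_span (by simp)
  have hy : y ∈ maximalIdeal S := hxy ▸ Ideal.subset_span (by simp)
  have key : ∀ z : maximalIdeal S ⊗[S] M, ∃ a b : M,
      z = (⟨x, hx⟩ : maximalIdeal S) ⊗ₜ a + (⟨y, hy⟩ : maximalIdeal S) ⊗ₜ b := by
    intro z
    induction z with
    | zero => exact ⟨0, 0, by simp⟩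
    | tmul s v =>
      obtain ⟨p, q, hpq⟩ := Ideal.mem_span_pair.1 (hxy.le s.2)
      refine ⟨p • v, q • v, ?_⟩
      rw [← TensorProduct.smul_tmul, ← TensorProduct.smul_tmul, ← TensorProduct.add_tmul]
      congr 1
      exact Subtype.ext (by simp [hpq])
    | add z z' hz hz' =>
      obtain ⟨a, b, rfl⟩ := hz
      obtain ⟨a', b', rfl⟩ := hz'
      exact ⟨a + a', b + b', by rw [TensorProduct.tmul_add, TensorProduct.tmul_add]; abel⟩
  rw [injective_iff_map_eq_zero]
  intro z hz
  obtain ⟨a, b, rfl⟩ := key z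
  have h0 : x • a + y • b = 0 := by
    simpa using congrArg (TensorProduct.lid S M) hz
  obtain ⟨w, rfl, rfl⟩ := H a b h0
  rw [TensorProduct.tmul_neg, ← TensorProduct.smul_tmul, ← TensorProduct.smul_tmul,
    ← sub_eq_add_neg, ← TensorProduct.sub_tmul]
  have h1 : y • (⟨x, hx⟩ : maximalIdeal S) - x • (⟨y, hy⟩ : maximalIdeal S) = 0 :=
    Subtype.ext (by simp [mul_comm])
  rw [h1, TensorProduct.zero_tmul]

end Koszul

section RegularLocal

variable {S : Type*} [CommRing S] [IsLocalRing S] [IsNoetherianRing S]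

lemma IsLocalRing.dvd_of_forall_mem_span_pair_pow {x y a : S} (hy : y ∈ maximalIdeal S)
    (h : ∀ k : ℕ, a ∈ Ideal.span {x, y ^ k}) : x ∣ a := by
  by_cases hx : IsUnit x
  · exact hx.dvd
  have : IsLocalRing (S ⧸ Ideal.span {x}) := by
    have : Nontrivial (S ⧸ Ideal.span {x}) := Ideal.Quotient.nontrivial_iff.2
      (by rwa [Ne, Ideal.span_singleton_eq_top])
    exact .of_surjective' (Ideal.Quotient.mk _) Ideal.Quotient.mk_surjective
  rw [← Ideal.Quotient.eq_zero_iff_dvd, ← Ideal.mem_bot, ← Ideal.iInf_pow_eq_bot_of_isLocalRing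
    (maximalIdeal (S ⧸ Ideal.span {x})) Ideal.IsPrime.ne_top', Ideal.mem_iInf]
  intro k
  obtain ⟨p, q, rfl⟩ := Ideal.mem_span_pair.1 (h k)
  rw [map_add, map_mul, map_mul, (Ideal.Quotient.eq_zero_iff_dvd x x).2 dvd_rfl, mul_zero, zero_add,
    map_pow]
  refine Ideal.mul_mem_left _ _ (Ideal.pow_mem_pow ?_ _)
  rw [mem_maximalIdeal, mem_nonunits_iff]
  intro hu
  obtain ⟨z, hz⟩ := hu.exists_right_inv
  obtain ⟨z, rfl⟩ := Ideal.Quotient.mk_surjective z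
  rw [← map_mul, ← map_one (Ideal.Quotient.mk _), Ideal.Quotient.eq] at hz
  have hx' : x ∈ maximalIdeal S := hx
  have h1 : y * z - 1 ∈ maximalIdeal S :=
    ((Ideal.span_singleton_le_iff_mem _).2 hx') hz
  have h2 := sub_mem (Ideal.mul_mem_right z _ hy) h1
  rw [sub_sub_cancel] at h2
  exact (Ideal.ne_top_iff_one _).1 Ideal.IsPrime.ne_top' h2

/-- Two elements that generate the maximal ideal of a two-dimensional local domain form a regular
sequence. -/
lemma IsLocalRing.isRegularPair [IsDomain S] {x y : S} (hxy : maximalIdeal S = Ideal.span {x, y})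
    (hdim : 1 < ringKrullDim S) : IsRegularPair x y := by
  have hheight : 1 < (maximalIdeal S).height := by
    rw [← maximalIdeal_height_eq_ringKrullDim] at hdim
    exact_mod_cast hdim
  have hx : x ∈ maximalIdeal S := hxy ▸ Ideal.subset_span (by simp)
  have hy : y ∈ maximalIdeal S := hxy ▸ Ideal.subset_span (by simp)
  have hpow : ∀ k : ℕ, ¬ x ∣ y ^ k := by
    intro k hk
    -- otherwise the maximal ideal would be minimal over `x`
    refine hheight.not_ge (Ideal.height_le_one_of_isPrincipal_of_mem_minimalPrimes
      (Ideal.span {x}) _ ⟨⟨inferInstance, ?_⟩, fun q ⟨hq, hxq⟩ _ => ?_⟩)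
    · rwa [Ideal.span_singleton_le_iff_mem]
    · rw [Ideal.span_singleton_le_iff_mem] at hxq
      rw [hxy, Ideal.span_le, Set.insert_subset_iff, Set.singleton_subset_iff]
      exact ⟨hxq, hq.mem_of_pow_mem k (q.mem_of_dvd hk hxq)⟩
  refine ⟨?_, fun a ha => dvd_of_forall_mem_span_pair_pow hy fun k => ?_⟩
  · rintro rfl
    refine hheight.not_ge (le_trans (Ideal.height_mono (J := Ideal.span {y}) ?_)
      (Ideal.height_span_singleton_le_one hy))
    rw [hxy, Ideal.span_insert_zero]
  · induction k with
    | zero => simp [Ideal.span_insert]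
    | succ k ih =>
      obtain ⟨b, c, rfl⟩ := Ideal.mem_span_pair.1 ih
      by_cases hc : IsUnit c
      · refine absurd ?_ (hpow (k + 1))
        have : x ∣ c * y ^ (k + 1) := by
          have h2 := dvd_sub ha (dvd_mul_left x (y * b))
          convert h2 using 1
          ring
        exact (hc.dvd_mul_left).1 this
      · obtain ⟨p, q, rfl⟩ := Ideal.mem_span_pair.1 (hxy ▸ (mem_maximalIdeal c).2 hc)
        exact Ideal.mem_span_pair.2 ⟨b + p * y ^ k, q, by ring⟩

end RegularLocal

lemma IsRegularLocalRing.isPrincipalIdealRing_or_exists_isRegularPair {S : Type*} [CommRing S]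
    [IsDomain S] [IsRegularLocalRing S] (hdim : ringKrullDim S ≤ 2) :
    IsPrincipalIdealRing S ∨ ∃ x y : S, maximalIdeal S = Ideal.span {x, y} ∧ IsRegularPair x y := by
  have h := IsRegularLocalRing.spanFinrank_maximalIdeal (R := S)
  rw [← h] at hdim
  have hfg : (maximalIdeal S).FG := (maximalIdeal S).fg_of_isNoetherianRing
  have hle : (maximalIdeal S).spanFinrank ≤ 2 := by exact_mod_cast hdim
  have hcard := Submodule.FG.generators_ncard hfg
  have hspan := (maximalIdeal S).span_generators
  rcases hle.lt_or_eq with hlt | heq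
  · left
    refine ((tfae_of_isNoetherianRing_of_isLocalRing_of_isDomain S).out 0 4).2 ?_
    interval_cases hr : (maximalIdeal S).spanFinrank
    · rw [(Submodule.spanFinrank_eq_zero_iff_eq_bot hfg).1 hr]
      infer_instance
    · exact ((Submodule.spanFinrank_eq_one_iff _).1 hr).1
  · right
    rw [heq] at hcard
    obtain ⟨x, y, -, hgen⟩ := Set.ncard_eq_two.1 hcard
    rw [hgen] at hspan
    refine ⟨x, y, hspan.symm, isRegularPair hspan.symm ?_⟩
    rw [← h, heq]
    norm_num

/-- Let all local rings of the noetherian domain `R` be regular of dimension at most two. A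
saturated submodule of a finite projective module is projective (it is a reflexive module). -/
theorem Module.projective_of_saturated {R G : Type*} [CommRing R] [IsDomain R] [IsNoetherianRing R]
    (hR : ∀ (p : Ideal R) [p.IsMaximal], IsRegularLocalRing (Localization.AtPrime p) ∧
      ringKrullDim (Localization.AtPrime p) ≤ 2)
    [AddCommGroup G] [Module R G] [Module.Finite R G] [Module.Projective R G] (N : Submodule R G)
    (hN : ∀ (r : R) (g : G), r ≠ 0 → r • g ∈ N → g ∈ N) : Module.Projective R N := by
  have : Module.FinitePresentation R N := Module.finitePresentation_of_finite R N
  refine Module.projective_of_localization_maximal fun p hp => ?_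
  obtain ⟨hreg, hdim⟩ := hR p
  let S := Localization.AtPrime p
  have : IsDomain S := IsLocalization.isDomain_localization p.primeCompl_le_nonZeroDivisors
  have hfree : Module.Free S (LocalizedModule p.primeCompl G) := Module.free_of_flat_of_isLocalRing
  let j : LocalizedModule p.primeCompl N →ₗ[S] LocalizedModule p.primeCompl G :=
    LocalizedModule.map p.primeCompl N.subtype
  have hj : Function.Injective j :=
    LocalizedModule.map_injective p.primeCompl N.subtype N.subtype_injective
  have hne : ∀ t : p.primeCompl, (t : R) ≠ 0 := fun t ht => t.2 (ht ▸ p.zero_mem)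
  have hsat : ∀ (s : S) (g : LocalizedModule p.primeCompl G), s ≠ 0 → s • g ∈ LinearMap.range j →
      g ∈ LinearMap.range j := by
    rintro s g hs ⟨n, hn⟩
    obtain ⟨r, u, rfl⟩ := IsLocalization.exists_mk'_eq p.primeCompl s
    induction g with | h g t
    induction n with | h n t'
    have hn' : LocalizedModule.mk ((u : R) • (n : G)) t' = LocalizedModule.mk (r • g) t := by
      rw [← LocalizedModule.smul'_mk, ← LocalizedModule.smul'_mk, ← algebraMap_smul S (u : R),
        ← algebraMap_smul S r, ← IsLocalization.mk'_spec' S r u, mul_smul, ← hn]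
      exact congrArg _ (LocalizedModule.map_mk p.primeCompl N.subtype n t').symm
    obtain ⟨c, hc⟩ := LocalizedModule.mk_eq.1 hn'
    have hr : r ≠ 0 := by
      rintro rfl
      exact hs (IsLocalization.mk'_zero u)
    refine ⟨LocalizedModule.mk ⟨g, hN (c * t' * r) g ?_ ?_⟩ t,
      LocalizedModule.map_mk p.primeCompl N.subtype _ t⟩
    · exact mul_ne_zero (mul_ne_zero (hne _) (hne _)) hr
    · rw [mul_smul, mul_smul]
      have hc' : (c : R) • (t' : R) • r • g = (c : R) • (t : R) • (u : R) • (n : G) := hc.symm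
      rw [hc']
      exact N.smul_mem _ (N.smul_mem _ (N.smul_mem _ n.2))
  have : Module.Free S (LocalizedModule p.primeCompl N) := by
    rcases IsRegularLocalRing.isPrincipalIdealRing_or_exists_isRegularPair (S := S) hdim with
      h | ⟨x, y, hxy, hreg⟩
    · have : Module.IsTorsionFree S (LocalizedModule p.primeCompl N) :=
        hj.moduleIsTorsionFree j (map_smul j)
      exact Module.free_of_finite_type_torsion_free'
    · refine Module.free_of_koszul hxy fun a b hab => ?_
      obtain ⟨w, ha, hb⟩ := hreg.exists_of_add_eq_zero (a := j a) (b := j b)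
        (by rw [← map_smul, ← map_smul, ← map_add, hab, map_zero])
      obtain ⟨w, rfl⟩ := hsat x w hreg.ne_zero ⟨-b, by rw [map_neg, hb, neg_neg]⟩
      exact ⟨w, hj (by rw [ha, map_smul]), hj (by rw [hb, map_neg, map_smul])⟩
  infer_instance

section Normal

variable {S : Type*} [CommRing S] [IsDomain S] [IsLocalRing S] [IsNoetherianRing S]

/-- A normal local domain whose maximal ideal is not principal has depth at least two. -/
lemma IsLocalRing.dvd_of_maximalIdeal_mul_le [IsIntegrallyClosed S]
    (hS : ¬ (maximalIdeal S).IsPrincipal) {x b : S} (hx : x ≠ 0)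
    (hb : ∀ z ∈ maximalIdeal S, x ∣ b * z) : x ∣ b := by
  let K := FractionRing S
  let t : K := algebraMap S K b / algebraMap S K x
  have hxK : algebraMap S K x ≠ 0 := by simpa using hx
  have ht : ∀ z ∈ maximalIdeal S, ∃ c : S, x * c = b * z ∧
      algebraMap S K c = t * algebraMap S K z := by
    intro z hz
    obtain ⟨c, hc⟩ := hb z hz
    refine ⟨c, hc.symm, ?_⟩
    have := congrArg (algebraMap S K) hc
    rw [map_mul, map_mul] at this
    simp only [t]
    rw [div_mul_eq_mul_div, this, mul_div_cancel_left₀ _ hxK]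
  by_cases hu : ∃ z ∈ maximalIdeal S, ∃ c : S, x * c = b * z ∧ IsUnit c
  · -- if the ideal `(b / x) * 𝔪` is not contained in `𝔪` then `𝔪` is principal
    obtain ⟨z, hz, c, hc, hcu⟩ := hu
    refine absurd ⟨z, le_antisymm (fun w hw => ?_) ?_⟩ hS
    · obtain ⟨d, hd⟩ := hb w hw
      refine Ideal.mem_span_singleton.2 ((hcu.dvd_mul_left (a := z)).1 ⟨d, ?_⟩)
      apply mul_left_cancel₀ hx
      linear_combination w * hc + z * hd
    · exact (Ideal.span_singleton_le_iff_mem _).2 hz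
  · have hint : IsIntegral S t := by
      refine isIntegral_of_smul_mem_submodule (M := K)
        (N := Submodule.map (Algebra.linearMap S K) (maximalIdeal S)) ?_ ?_ t ?_
      · intro h
        have h : maximalIdeal S = ⊥ := (Submodule.eq_bot_iff _).2 fun z hz =>
          IsFractionRing.injective S K (by
            rw [map_zero]
            exact (Submodule.mem_bot S).1 (h ▸ Submodule.mem_map_of_mem hz))
        exact hS (by rw [h]; infer_instance)
      · exact Submodule.FG.map _ (maximalIdeal S).fg_of_isNoetherianRing
      · rintro _ ⟨z, hz, rfl⟩
        obtain ⟨c, hc, hc'⟩ := ht z hz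
        refine ⟨c, (mem_maximalIdeal c).2 fun hcu => hu ⟨z, hz, c, hc, hcu⟩, ?_⟩
        rw [Algebra.linearMap_apply, hc', smul_eq_mul, Algebra.linearMap_apply]
    obtain ⟨c, hc⟩ := IsIntegrallyClosed.isIntegral_iff.1 hint
    refine ⟨c, IsFractionRing.injective S K ?_⟩
    rw [map_mul, hc, mul_div_cancel₀ _ hxK]

/-- A normal local domain of dimension two contains a regular sequence `x, y`, and the maximal ideal
is associated to `(x, y)`. -/
lemma IsLocalRing.exists_isRegularPair [IsIntegrallyClosed S] (hdim : ringKrullDim S = 2) :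
    ∃ x y s : S, x ∈ maximalIdeal S ∧ y ∈ maximalIdeal S ∧ IsRegularPair x y ∧
      s ∉ Ideal.span {x, y} ∧ ∀ z ∈ maximalIdeal S, s * z ∈ Ideal.span {x, y} := by
  have hheight : (maximalIdeal S).height = 2 := by
    rw [← maximalIdeal_height_eq_ringKrullDim] at hdim
    exact WithBot.coe_injective hdim
  have hprin : ¬ (maximalIdeal S).IsPrincipal := by
    intro h
    have h1 := Ideal.height_le_one_of_isPrincipal_of_mem_minimalPrimes (maximalIdeal S)
      (maximalIdeal S) (by rw [Ideal.minimalPrimes_eq_subsingleton_self]; rfl)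
    rw [hheight] at h1
    exact absurd h1 (by decide)
  obtain ⟨x, hx, hx0⟩ : ∃ x ∈ maximalIdeal S, x ≠ 0 := by
    by_contra! h
    exact hprin (by rw [(Submodule.eq_bot_iff _).2 h]; infer_instance)
  have hass : maximalIdeal S ∉ associatedPrimes S (S ⧸ Ideal.span {x}) := by
    intro h
    obtain ⟨-, b, hb⟩ := isAssociatedPrime_iff.1 h
    obtain ⟨b, rfl⟩ := Ideal.Quotient.mk_surjective b
    have hmem : ∀ z, z ∈ maximalIdeal S ↔ x ∣ b * z := fun z => by
      rw [hb, Submodule.mem_colon_singleton, Submodule.mem_bot, ← Ideal.Quotient.eq_zero_iff_dvd,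
        mul_comm, map_mul]
      rfl
    have := dvd_of_maximalIdeal_mul_le hprin hx0 fun z hz => (hmem z).1 hz
    exact (Ideal.ne_top_iff_one _).1 Ideal.IsPrime.ne_top' ((hmem 1).2 (by rwa [mul_one]))
  obtain ⟨y, hy, hy'⟩ : ∃ y ∈ maximalIdeal S,
      ∀ p ∈ associatedPrimes S (S ⧸ Ideal.span {x}), y ∉ p := by
    by_contra! h
    have hfin := associatedPrimes.finite S (S ⧸ Ideal.span {x})
    obtain ⟨p, hp, hle⟩ := (Ideal.subset_union_prime_finite hfin (f := id) 0 0
      (fun p hp _ _ => hp.1) (I := maximalIdeal S)).1 (fun y hy => by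
        obtain ⟨p, hp, hyp⟩ := h y hy
        exact Set.mem_biUnion hp hyp)
    rw [(IsLocalRing.maximalIdeal.isMaximal S).eq_of_le hp.1.ne_top hle] at hass
    exact hass hp
  have hreg : IsRegularPair x y := by
    refine ⟨hx0, fun a ha => ?_⟩
    by_contra hxa
    have : Ideal.Quotient.mk (Ideal.span {x}) a ≠ 0 := by
      rwa [Ne, Ideal.Quotient.eq_zero_iff_dvd]
    obtain ⟨p, hp, hle⟩ := exists_le_isAssociatedPrime_of_isNoetherianRing S _ this
    refine hy' p hp (hle ?_)
    rw [Submodule.mem_colon_singleton, Submodule.mem_bot]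
    exact (Ideal.Quotient.eq_zero_iff_dvd x (y * a)).2 ha
  have hne : (1 : S ⧸ Ideal.span {x, y}) ≠ 0 := by
    rw [← map_one (Ideal.Quotient.mk _), Ne, Ideal.Quotient.eq_zero_iff_mem]
    intro h1
    refine (Ideal.ne_top_iff_one _).1 Ideal.IsPrime.ne_top' ((?_ : _ ≤ maximalIdeal S) h1)
    rw [Ideal.span_le, Set.insert_subset_iff, Set.singleton_subset_iff]
    exact ⟨hx, hy⟩
  obtain ⟨p, hp', hle⟩ := exists_le_isAssociatedPrime_of_isNoetherianRing S _ hne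
  obtain ⟨hp, c, hc⟩ := isAssociatedPrime_iff.1 hp'
  obtain ⟨s, rfl⟩ := Ideal.Quotient.mk_surjective c
  have hmem : ∀ z : S, z ∈ p ↔ s * z ∈ Ideal.span {x, y} := by
    intro z
    rw [hc, Submodule.mem_colon_singleton, Submodule.mem_bot, ← Ideal.Quotient.eq_zero_iff_mem,
      mul_comm, map_mul]
    rfl
  have hxp : x ∈ p := (hmem x).2 (Ideal.mul_mem_left _ _ (Ideal.subset_span (by simp)))
  have hyp : y ∈ p := (hmem y).2 (Ideal.mul_mem_left _ _ (Ideal.subset_span (by simp)))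
  have hpm : p = maximalIdeal S := by
    by_contra hpm
    have hlt : p < maximalIdeal S := lt_of_le_of_ne (le_maximalIdeal hp.ne_top) hpm
    have h1 := Ideal.height_add_one_le_of_lt_of_isPrime hlt
    have hmin : p ∈ (Ideal.span {x}).minimalPrimes := by
      refine ⟨⟨hp, (Ideal.span_singleton_le_iff_mem _).2 hxp⟩, fun q ⟨hq, hxq⟩ hqp => ?_⟩
      by_contra hqp'
      have h2 := Ideal.height_add_one_le_of_lt_of_isPrime (lt_of_le_not_ge hqp hqp')
      have h3 : (⊥ : Ideal S) < q := bot_lt_iff_ne_bot.2 fun h => hx0 (by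
        simpa [h] using hxq)
      have h4 := Ideal.height_add_one_le_of_lt_of_isPrime h3
      have h5 : (2 : ℕ∞) + 1 ≤ 2 := by
        calc (2 : ℕ∞) + 1 = 0 + 1 + 1 + 1 := by norm_num
          _ ≤ (⊥ : Ideal S).height + 1 + 1 + 1 := by gcongr; exact zero_le
          _ ≤ q.height + 1 + 1 := by gcongr
          _ ≤ p.height + 1 := by gcongr
          _ ≤ 2 := hheight ▸ h1
      exact absurd h5 (by decide)
    refine hy' p ?_ hyp
    refine Module.associatedPrimes.minimalPrimes_annihilator_subset_associatedPrimes S _ ?_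
    rwa [Ideal.annihilator_quotient]
  refine ⟨x, y, s, hx, hy, hreg, fun hs => ?_, fun z hz => (hmem z).1 (hpm ▸ hz)⟩
  exact hp.ne_top ((Ideal.eq_top_iff_one _).2 ((hmem 1).2 (by simpa using hs)))

omit [IsDomain S] [IsNoetherianRing S] in
/-- The relations between the members of a minimal system of generators of the maximal ideal have
coefficients in the maximal ideal. -/
lemma IsLocalRing.mem_maximalIdeal_of_relation {n : ℕ} {g : Fin n → S}
    (hg : Ideal.span (Set.range g) = maximalIdeal S) (hn : (maximalIdeal S).spanFinrank = n)
    {w : Fin n → S} (hw : ∑ i, w i * g i = 0) (i : Fin n) : w i ∈ maximalIdeal S := by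
  rw [mem_maximalIdeal, mem_nonunits_iff]
  intro hu
  have hspan : maximalIdeal S = Ideal.span (g '' {i}ᶜ) := by
    rw [← hg]
    refine le_antisymm (Ideal.span_le.2 ?_) (Ideal.span_mono (Set.image_subset_range _ _))
    rintro _ ⟨j, rfl⟩
    by_cases hj : j = i
    · subst hj
      refine (Ideal.unit_mul_mem_iff_mem _ hu).1 ?_
      rw [← Finset.add_sum_erase _ _ (Finset.mem_univ j)] at hw
      rw [eq_neg_of_add_eq_zero_left hw]
      refine neg_mem (Ideal.sum_mem _ fun k hk => Ideal.mul_mem_left _ _ (Ideal.subset_span ?_))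
      exact Set.mem_image_of_mem _ (Finset.ne_of_mem_erase hk)
    · exact Ideal.subset_span (Set.mem_image_of_mem _ hj)
  have h1 : (maximalIdeal S).spanFinrank ≤ ({i}ᶜ : Set (Fin n)).ncard := by
    rw [hspan]
    exact (Submodule.spanFinrank_span_le_ncard_of_finite (Set.toFinite _)).trans
      (Set.ncard_image_le (Set.toFinite _))
  rw [hn, Set.ncard_compl, Set.ncard_singleton, Nat.card_eq_fintype_card, Fintype.card_fin] at h1
  have := i.pos
  omega

/-- Let `S` be a local domain such that `𝔪` is associated to a regular sequence `x, y`. If the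
module of relations between minimal generators of `𝔪` is projective then `𝔪` has two generators.
The reason is that `Tor₂(k, S/(x, y))` is one-dimensional by the Koszul resolution of `S/(x, y)`,
whereas the minimal resolution of `k` shows that it contains a copy of the socle of `S/(x, y)` for
every basis vector of the relation module. -/
theorem IsLocalRing.le_two_of_projective_relations {n : ℕ} {g : Fin n → S}
    (hg : Ideal.span (Set.range g) = maximalIdeal S) (hn : (maximalIdeal S).spanFinrank = n)
    [Module.Projective S (LinearMap.ker (Fintype.linearCombination S g))] {x y s : S}
    (hxy : IsRegularPair x y) (hs : s ∉ Ideal.span {x, y})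
    (hs' : ∀ z ∈ maximalIdeal S, s * z ∈ Ideal.span {x, y}) : n ≤ 2 := by
  by_contra! hn2
  set G := Fintype.linearCombination S g with hG
  have hGapp : ∀ w, G w = ∑ i, w i * g i := fun w => by
    simp [hG, Fintype.linearCombination_apply]
  have hfree : Module.Free S (LinearMap.ker G) := Module.free_of_flat_of_isLocalRing
  have hrank : 2 ≤ Module.finrank S (LinearMap.ker G) := by
    have h1 := Submodule.finrank_quotient_add_finrank (LinearMap.ker G)
    rw [G.quotKerEquivRange.finrank_eq] at h1
    have h2 := Submodule.finrank_le (LinearMap.range G)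
    rw [Module.finrank_self] at h2
    rw [Module.finrank_fin_fun] at h1
    omega
  let b := Module.finBasis S (LinearMap.ker G)
  -- the two components of a Koszul relation attached to a relation `w`
  have hkos : ∀ w : LinearMap.ker G, ∃ (u v : Fin n → S) (c : S), s • (w : Fin n → S) =
      x • u + y • v ∧ G u = y * c ∧ G v = -(x * c) := by
    intro w
    have hw := w.2
    rw [LinearMap.mem_ker] at hw
    choose u v huv using fun i => Ideal.mem_span_pair.1 (hs' _
      (mem_maximalIdeal_of_relation hg hn ((hGapp w).symm.trans hw) i))
    have h1 : s • (w : Fin n → S) = x • u + y • v := by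
      ext i
      simp [← huv i, mul_comm]
    obtain ⟨c, hc, hc'⟩ := hxy.exists_of_add_eq_zero (a := G u) (b := G v) (by
      rw [← map_smul, ← map_smul, ← map_add, ← h1, map_smul, hw, smul_zero])
    exact ⟨u, v, c, h1, hc, hc'⟩
  have hlift : ∀ (w : LinearMap.ker G) (u v : Fin n → S) (c : S), s • (w : Fin n → S) =
      x • u + y • v → G u = y * c → G v = -(x * c) → c ∈ maximalIdeal S →
      ∃ u' v' : LinearMap.ker G, s • w = x • u' + y • v' := by
    intro w u v c h1 hu hv hc
    obtain ⟨z, rfl⟩ : ∃ z, G z = c := by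
      have : c ∈ LinearMap.range G := by
        rw [hG, Fintype.range_linearCombination]
        exact hg.ge hc
      exact this
    refine ⟨⟨u - y • z, by rw [LinearMap.mem_ker, map_sub, map_smul, hu, smul_eq_mul, sub_self]⟩,
      ⟨v + x • z, by rw [LinearMap.mem_ker, map_add, map_smul, hv, smul_eq_mul, neg_add_cancel]⟩,
      Subtype.ext ?_⟩
    push_cast
    rw [h1]
    module
  have hend : ∀ (w : LinearMap.ker G) (φ : LinearMap.ker G →ₗ[S] S), IsUnit (φ w) →
      ¬ ∃ u' v' : LinearMap.ker G, s • w = x • u' + y • v' := by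
    rintro w φ hφ ⟨u', v', h⟩
    have h1 := congrArg φ h
    simp only [map_add, map_smul, smul_eq_mul] at h1
    refine hs ((Ideal.mul_unit_mem_iff_mem _ hφ).1 ?_)
    rw [h1]
    exact Ideal.mem_span_pair.2 ⟨φ u', φ v', by ring⟩
  let i₀ : Fin (Module.finrank S (LinearMap.ker G)) := ⟨0, by omega⟩
  let i₁ : Fin (Module.finrank S (LinearMap.ker G)) := ⟨1, by omega⟩
  have hi : i₁ ≠ i₀ := by simp [i₀, i₁]
  obtain ⟨u₀, v₀, c₀, h₀, hu₀, hv₀⟩ := hkos (b i₀)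
  obtain ⟨u₁, v₁, c₁, h₁, hu₁, hv₁⟩ := hkos (b i₁)
  by_cases hc₁ : c₁ ∈ maximalIdeal S
  · exact hend (b i₁) (b.coord i₁) (by simp) (hlift _ _ _ _ h₁ hu₁ hv₁ hc₁)
  · refine hend (c₁ • b i₀ - c₀ • b i₁) (b.coord i₀) ?_ (hlift _ (c₁ • u₀ - c₀ • u₁)
      (c₁ • v₀ - c₀ • v₁) 0 ?_ ?_ ?_ (zero_mem _))
    · rw [mem_maximalIdeal, mem_nonunits_iff, not_not] at hc₁
      simpa [hi] using hc₁
    · push_cast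
      rw [smul_sub, smul_comm s c₁, smul_comm s c₀, h₀, h₁]
      module
    · simp only [map_sub, map_smul, hu₀, hu₁, smul_eq_mul]
      ring
    · simp only [map_sub, map_smul, hv₀, hv₁, smul_eq_mul]
      ring

/-- A normal local domain of dimension at most two is regular if the module of relations between
minimal generators of the maximal ideal is projective. -/
theorem IsRegularLocalRing.of_projective_relations [IsIntegrallyClosed S]
    (hdim : ringKrullDim S ≤ 2) (h : ∀ (n : ℕ) (g : Fin n → S),
      Ideal.span (Set.range g) = maximalIdeal S → (maximalIdeal S).spanFinrank = n →
        Module.Projective S (LinearMap.ker (Fintype.linearCombination S g))) :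
    IsRegularLocalRing S := by
  rcases hdim.lt_or_eq with hlt | heq
  · have hheight : (maximalIdeal S).height ≤ 1 := by
      rw [← maximalIdeal_height_eq_ringKrullDim] at hlt
      refine Order.le_of_lt_add_one ?_
      rw [one_add_one_eq_two]
      exact WithBot.coe_lt_coe.1 hlt
    have : IsPrincipalIdealRing S := by
      have htfae : IsPrincipalIdealRing S ↔ IsIntegrallyClosed S ∧
          ∀ P : Ideal S, P ≠ ⊥ → P.IsPrime → P = maximalIdeal S :=
        (tfae_of_isNoetherianRing_of_isLocalRing_of_isDomain S).out 0 3
      refine htfae.2 ⟨inferInstance, fun P hP hPp => ?_⟩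
      by_contra hPm
      have h1 := Ideal.height_add_one_le_of_lt_of_isPrime (bot_lt_iff_ne_bot.2 hP)
      have h2 := Ideal.height_add_one_le_of_lt_of_isPrime
        (lt_of_le_of_ne (le_maximalIdeal hPp.ne_top) hPm)
      have h3 : (0 : ℕ∞) + 1 + 1 ≤ 1 := by
        calc (0 : ℕ∞) + 1 + 1 ≤ (⊥ : Ideal S).height + 1 + 1 := by gcongr; exact zero_le
          _ ≤ P.height + 1 := by gcongr
          _ ≤ 1 := h2.trans hheight
      exact absurd h3 (by decide)
    infer_instance
  · obtain ⟨x, y, s, -, -, hxy, hs, hs'⟩ := exists_isRegularPair heq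
    have hfg : (maximalIdeal S).FG := (maximalIdeal S).fg_of_isNoetherianRing
    have hcard := Submodule.FG.generators_ncard hfg
    have : Finite (maximalIdeal S).generators := Submodule.FG.finite_generators hfg
    let e : Fin (maximalIdeal S).spanFinrank ≃ (maximalIdeal S).generators :=
      (finCongr (by rw [← hcard]; rfl)).trans (Finite.equivFin _).symm
    have hg : Ideal.span (Set.range fun i => (e i : S)) = maximalIdeal S := by
      conv_rhs => rw [← (maximalIdeal S).span_generators]
      congr 1
      ext z
      constructor
      · rintro ⟨i, rfl⟩
        exact (e i).2
      · exact fun hz => ⟨e.symm ⟨z, hz⟩, by simp⟩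
    have := h _ _ hg rfl
    refine IsRegularLocalRing.of_spanFinrank_maximalIdeal_le S ?_
    rw [heq]
    exact_mod_cast le_two_of_projective_relations hg rfl hxy hs hs'

end Normal

section Relations

variable {R S : Type*} [CommRing R] [CommRing S] [Algebra R S]

open scoped nonZeroDivisors in
/-- The formation of modules of relations commutes with localization. -/
lemma Module.projective_relations_of_isLocalization (M : Submonoid R) (hM : M ≤ R⁰)
    [IsLocalization M S] {n : ℕ} (a : Fin n → R) (g : Fin n → S) (s : S) (hs : IsUnit s)
    (hag : ∀ i, algebraMap R S (a i) = s * g i)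
    [Module.Projective R (LinearMap.ker (Fintype.linearCombination R a))] :
    Module.Projective S (LinearMap.ker (Fintype.linearCombination S g)) := by
  have hinj : Function.Injective (algebraMap R S) := IsLocalization.injective S hM
  have hmem (c : Fin n → R) : (fun i => algebraMap R S (c i)) ∈
      LinearMap.ker (Fintype.linearCombination S g) ↔
      c ∈ LinearMap.ker (Fintype.linearCombination R a) := by
    rw [LinearMap.mem_ker, LinearMap.mem_ker, Fintype.linearCombination_apply,
      Fintype.linearCombination_apply, ← hs.mul_right_eq_zero, ← map_eq_zero_iff _ hinj,
      Finset.mul_sum, map_sum]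
    simp only [smul_eq_mul, map_mul, hag]
    refine Eq.congr (Finset.sum_congr rfl fun i _ => by ring) rfl
  let f : LinearMap.ker (Fintype.linearCombination R a) →ₗ[R]
      LinearMap.ker (Fintype.linearCombination S g) :=
    { toFun := fun c => ⟨fun i => algebraMap R S (c.1 i), (hmem c).2 c.2⟩
      map_add' := fun c d => by ext i; simp
      map_smul' := fun r c => by
        ext i
        simp [Algebra.smul_def] }
  have : IsLocalizedModule M f :=
    { map_units := fun m => by
        rw [Module.End.isUnit_iff]
        obtain ⟨v, hv⟩ := IsLocalization.map_units S m
        have hm (c : LinearMap.ker (Fintype.linearCombination S g)) :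
            algebraMap R (Module.End R (LinearMap.ker (Fintype.linearCombination S g))) m c =
              (v : S) • c := by
          rw [hv, algebraMap_smul]
          rfl
        constructor
        · intro c d h
          rw [hm, hm] at h
          simpa [smul_smul] using congrArg ((↑v⁻¹ : S) • ·) h
        · intro c
          exact ⟨(↑v⁻¹ : S) • c, by rw [hm, smul_smul, Units.mul_inv, one_smul]⟩
      surj := fun c => by
        obtain ⟨m, hm⟩ := IsLocalization.exist_integer_multiples_of_finite M c.1
        choose d hd using hm
        refine ⟨⟨⟨d, (hmem d).1 ?_⟩, m⟩, ?_⟩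
        · have : (fun i => algebraMap R S (d i)) = algebraMap R S m • c.1 := by
            ext i
            rw [hd i, Algebra.smul_def]
            rfl
          rw [this]
          exact Submodule.smul_mem _ _ c.2
        · ext i
          exact (hd i).symm
      exists_of_eq := fun {c d} h => ⟨1, by
        have : c = d := by
          ext i
          exact hinj (congrFun (congrArg Subtype.val h) i)
        rw [this]⟩ }
  exact Module.projective_of_isLocalizedModule M f

end Relations

end

/-! ### Lattices over the rings of functions on affine open sets -/

section

open CategoryTheory

variable {X : Scheme.{u}} [IsIntegral X]

variable (X) in
/-- A nonempty affine open subset of `X`. -/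
structure AffinePatch where
  /-- The underlying open set. -/
  opens : X.Opens
  /-- The open set is not empty. -/
  nonempty : Nonempty opens
  /-- The open set is affine. -/
  isAffine : IsAffineOpen opens

namespace AffinePatch

attribute [instance] AffinePatch.nonempty

/-- The functions on a nonempty affine open set, as a subring of the function field. -/
noncomputable abbrev functions (W : AffinePatch X) : Subring X.functionField :=
  (X.germToFunctionField W.opens).hom.range

/-- `W'` is the set where the function `f` on `W` does not vanish; here `f` is given as an element
of the function field. -/
def IsBasic (W W' : AffinePatch X) (f : X.functionField) : Prop :=
  ∃ s : Γ(X, W.opens), X.germToFunctionField W.opens s = f ∧ W'.opens = X.basicOpen s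

lemma germToFunctionField_res {U V : X.Opens} [Nonempty U] [Nonempty V] (h : V ≤ U) (s : Γ(X, U)) :
    X.germToFunctionField V (X.presheaf.map (homOfLE h).op s) = X.germToFunctionField U s :=
  X.presheaf.germ_res_apply (homOfLE h) _ _ s

@[simp]
lemma algebraMap_functions (W : AffinePatch X) (k : W.functions) :
    algebraMap W.functions X.functionField k = k := rfl

lemma functions_mono {W W' : AffinePatch X} (h : W'.opens ≤ W.opens) :
    W.functions ≤ W'.functions := by
  rintro _ ⟨s, rfl⟩
  exact ⟨_, germToFunctionField_res h s⟩

/-- The ring of functions on `W` is the ring of sections over `W`. -/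
noncomputable def sectionsEquiv (W : AffinePatch X) : Γ(X, W.opens) ≃+* W.functions :=
  RingEquiv.ofBijective (X.germToFunctionField W.opens).hom.rangeRestrict
    ⟨fun _ _ h => X.germToFunctionField_injective W.opens (congrArg Subtype.val h),
      (X.germToFunctionField W.opens).hom.rangeRestrict_surjective⟩

instance (W : AffinePatch X) : IsFractionRing W.functions X.functionField := by
  have := functionField_isFractionRing_of_isAffineOpen X W.opens W.isAffine
  refine IsFractionRing.of_field _ _ fun k => ?_
  obtain ⟨a, b, -, rfl⟩ := IsFractionRing.div_surjective Γ(X, W.opens) k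
  exact ⟨W.sectionsEquiv a, W.sectionsEquiv b, rfl⟩

instance [IsLocallyNoetherian X] (W : AffinePatch X) : IsNoetherianRing W.functions :=
  have : IsNoetherianRing Γ(X, W.opens) :=
    IsLocallyNoetherian.component_noetherian ⟨W.opens, W.isAffine⟩
  isNoetherianRing_of_ringEquiv _ W.sectionsEquiv

variable {W W' : AffinePatch X} {f : X.functionField}

lemma IsBasic.le (h : IsBasic W W' f) : W'.opens ≤ W.opens := by
  obtain ⟨s, -, h⟩ := h
  rw [h]
  exact X.basicOpen_le s

lemma IsBasic.mem (h : IsBasic W W' f) : f ∈ W.functions := by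
  obtain ⟨s, rfl, -⟩ := h
  exact ⟨s, rfl⟩

lemma IsBasic.exists_inv (h : IsBasic W W' f) : ∃ g ∈ W'.functions, g * f = 1 := by
  obtain ⟨s, rfl, h⟩ := h
  obtain ⟨U, hU, hU'⟩ := W'
  subst h
  obtain ⟨t, ht⟩ := (X.toRingedSpace.isUnit_res_basicOpen s).exists_left_inv
  refine ⟨X.germToFunctionField (X.basicOpen s) t, ⟨t, rfl⟩, ?_⟩
  have h1 := congrArg (X.germToFunctionField (X.basicOpen s)) ht
  erw [map_mul, map_one, germToFunctionField_res (X.basicOpen_le s)] at h1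
  exact h1

lemma IsBasic.inv_mem (h : IsBasic W W' f) : f⁻¹ ∈ W'.functions := by
  obtain ⟨g, hg, hgf⟩ := h.exists_inv
  rwa [inv_eq_of_mul_eq_one_left hgf]

lemma IsBasic.ne_zero (h : IsBasic W W' f) : f ≠ 0 := by
  obtain ⟨g, hg, hgf⟩ := h.exists_inv
  exact right_ne_zero_of_mul_eq_one hgf

lemma IsBasic.mem_functions_iff (h : IsBasic W W' f) (k : X.functionField) :
    k ∈ W'.functions ↔ ∃ n : ℕ, f ^ n * k ∈ W.functions := by
  constructor
  · obtain ⟨s, rfl, h⟩ := h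
    obtain ⟨U, hU, hU'⟩ := W'
    subst h
    rintro ⟨t, rfl⟩
    have := W.isAffine.isLocalization_basicOpen s
    obtain ⟨n, a, ha⟩ := IsLocalization.Away.surj s t
    refine ⟨n, a, ?_⟩
    have h1 := congrArg (X.germToFunctionField (X.basicOpen s)) ha
    rw [map_mul, map_pow] at h1
    erw [germToFunctionField_res (X.basicOpen_le s),
      germToFunctionField_res (X.basicOpen_le s)] at h1
    rw [mul_comm]
    exact h1.symm
  · rintro ⟨n, hn⟩
    rw [← inv_mul_cancel_left₀ (pow_ne_zero n h.ne_zero) k, ← inv_pow]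
    exact mul_mem (pow_mem h.inv_mem n) (functions_mono h.le hn)

/-- The basic open subset of `W` where `s` does not vanish. -/
def basicOpen (W : AffinePatch X) (s : Γ(X, W.opens)) [h : Nonempty (X.basicOpen s)] :
    AffinePatch X := ⟨X.basicOpen s, h, W.isAffine.basicOpen s⟩

lemma isBasic_basicOpen (W : AffinePatch X) (s : Γ(X, W.opens)) [Nonempty (X.basicOpen s)] :
    IsBasic W (W.basicOpen s) (X.germToFunctionField W.opens s) :=
  ⟨s, rfl, rfl⟩

end AffinePatch

variable (X) in
/-- A coherent sheaf of lattices in the vector space `V` over the function field of `X`, given by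
its modules of sections over the nonempty affine open sets. -/
structure LatticeSheaf (V : Type*) [AddCommGroup V] [Module X.functionField V] where
  /-- The sections over a nonempty affine open set. -/
  sec (W : AffinePatch X) : Submodule W.functions V
  /-- The sections over a basic open set are obtained by localization. -/
  mem_iff_of_isBasic {W W' : AffinePatch X} {f : X.functionField} (h : W.IsBasic W' f) (v : V) :
    v ∈ sec W' ↔ ∃ n : ℕ, f ^ n • v ∈ sec W
  /-- The modules of sections are finitely generated. -/
  fg (W : AffinePatch X) : (sec W).FG
  /-- The sections span `V`. -/
  span_eq_top (W : AffinePatch X) : Submodule.span X.functionField (sec W : Set V) = ⊤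

namespace LatticeSheaf

variable {V V₁ V₂ V₃ : Type*} [AddCommGroup V] [Module X.functionField V]
  [AddCommGroup V₁] [Module X.functionField V₁] [AddCommGroup V₂] [Module X.functionField V₂]
  [AddCommGroup V₃] [Module X.functionField V₃]

lemma smul_mem (L : LatticeSheaf X V) {W : AffinePatch X} {k : X.functionField}
    (hk : k ∈ W.functions) {v : V} (hv : v ∈ L.sec W) : k • v ∈ L.sec W :=
  (L.sec W).smul_mem ⟨k, hk⟩ hv

lemma exists_smul_mem (L : LatticeSheaf X V) (W : AffinePatch X) (v : V) :
    ∃ d ∈ W.functions, d ≠ 0 ∧ d • v ∈ L.sec W := by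
  have hv : v ∈ Submodule.span X.functionField (L.sec W : Set V) := by
    rw [L.span_eq_top]
    trivial
  induction hv using Submodule.span_induction with
  | mem v hv => exact ⟨1, one_mem _, one_ne_zero, by rwa [one_smul]⟩
  | zero => exact ⟨1, one_mem _, one_ne_zero, by rw [smul_zero]; exact zero_mem _⟩
  | add v w _ _ hv hw =>
    obtain ⟨d, hd, hd0, hdv⟩ := hv
    obtain ⟨e, he, he0, hew⟩ := hw
    refine ⟨d * e, mul_mem hd he, mul_ne_zero hd0 he0, ?_⟩
    rw [smul_add]
    refine add_mem ?_ ?_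
    · rw [mul_comm, mul_smul]
      exact L.smul_mem he hdv
    · rw [mul_smul]
      exact L.smul_mem hd hew
  | smul k v _ hv =>
    obtain ⟨d, hd, hd0, hdv⟩ := hv
    obtain ⟨a, b, hb, rfl⟩ := IsFractionRing.div_surjective W.functions k
    have hb0 : (b : X.functionField) ≠ 0 := fun h =>
      nonZeroDivisors.ne_zero hb (Subtype.ext h)
    refine ⟨b * d, mul_mem b.2 hd, mul_ne_zero hb0 hd0, ?_⟩
    rw [smul_smul, show (b : X.functionField) * d * (algebraMap W.functions X.functionField a /
      algebraMap W.functions X.functionField b) = a * d by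
        simp only [AffinePatch.algebraMap_functions]
        field_simp, mul_smul]
    exact L.smul_mem a.2 hdv

lemma exists_smul_mem_finset (L : LatticeSheaf X V) (W : AffinePatch X) {ι : Type*} (s : Finset ι)
    (v : ι → V) : ∃ d ∈ W.functions, d ≠ 0 ∧ ∀ i ∈ s, d • v i ∈ L.sec W := by
  choose d hd hd0 hdv using fun i => L.exists_smul_mem W (v i)
  classical
  refine ⟨∏ i ∈ s, d i, prod_mem fun i _ => hd i, Finset.prod_ne_zero_iff.2 fun i _ => hd0 i,
    fun i hi => ?_⟩
  rw [← Finset.prod_erase_mul s d hi, mul_smul]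
  exact L.smul_mem (prod_mem fun i _ => hd i) (hdv i)

/-- Membership in the sections over an affine open set can be checked on a basic open covering. -/
lemma mem_of_forall_isBasic (L : LatticeSheaf X V) {W : AffinePatch X} {v : V}
    (h : ∀ x ∈ W.opens, ∃ (W' : AffinePatch X) (f : X.functionField), x ∈ W'.opens ∧
      W.IsBasic W' f ∧ v ∈ L.sec W') : v ∈ L.sec W := by
  let I : Ideal Γ(X, W.opens) :=
    { carrier := {s | X.germToFunctionField W.opens s • v ∈ L.sec W}
      add_mem' := fun {a b} ha hb => by
        simp only [Set.mem_ofPred_eq, map_add, add_smul] at ha hb ⊢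
        exact add_mem ha hb
      zero_mem' := by simp
      smul_mem' := fun c a ha => by
        simp only [Set.mem_ofPred_eq, smul_eq_mul, map_mul, mul_smul] at ha ⊢
        exact L.smul_mem ⟨c, rfl⟩ ha }
  have hI : Ideal.span (I : Set Γ(X, W.opens)) = ⊤ := by
    rw [← W.isAffine.iSup_basicOpen_eq_self_iff]
    refine le_antisymm (iSup_le fun s => X.basicOpen_le s.1) fun x hx => ?_
    obtain ⟨W', f, hxW', hf, hv⟩ := h x hx
    obtain ⟨n, hn⟩ := (L.mem_iff_of_isBasic hf v).1 hv
    obtain ⟨s, rfl, hs⟩ := hf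
    have hsI : s ^ (n + 1) ∈ I := by
      change X.germToFunctionField W.opens (s ^ (n + 1)) • v ∈ L.sec W
      rw [map_pow, pow_succ', mul_smul]
      exact L.smul_mem ⟨s, rfl⟩ hn
    refine TopologicalSpace.Opens.mem_iSup.2 ⟨⟨_, hsI⟩, ?_⟩
    rw [Scheme.basicOpen_pow _ _ n.succ_pos, ← hs]
    exact hxW'
  rw [Ideal.span_eq, Ideal.eq_top_iff_one] at hI
  have h1 : X.germToFunctionField W.opens 1 • v ∈ L.sec W := hI
  rwa [map_one, one_smul] at h1

lemma sec_anti (L : LatticeSheaf X V) {W W' : AffinePatch X} (h : W'.opens ≤ W.opens) {v : V}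
    (hv : v ∈ L.sec W) : v ∈ L.sec W' := by
  refine L.mem_of_forall_isBasic fun x hx => ?_
  obtain ⟨f, g, hfg, hxf⟩ := exists_basicOpen_le_affine_inter W.isAffine W'.isAffine x ⟨h hx, hx⟩
  have hne : Nonempty (X.basicOpen f) := ⟨⟨x, hxf⟩⟩
  refine ⟨W.basicOpen f, X.germToFunctionField W'.opens g, hxf, ⟨g, rfl, hfg⟩, ?_⟩
  exact (L.mem_iff_of_isBasic (W.isBasic_basicOpen f) v).2 ⟨0, by simpa⟩

lemma mem_range_linearMap_functions {W : AffinePatch X} {k : X.functionField} :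
    k ∈ LinearMap.range (Algebra.linearMap W.functions X.functionField) ↔ k ∈ W.functions :=
  ⟨fun ⟨a, ha⟩ => ha ▸ a.2, fun h => ⟨⟨k, h⟩, rfl⟩⟩

/-- The structure sheaf. -/
noncomputable def structureSheaf : LatticeSheaf X X.functionField where
  sec W := LinearMap.range (Algebra.linearMap W.functions X.functionField)
  mem_iff_of_isBasic h v := by
    simp only [smul_eq_mul, mem_range_linearMap_functions]
    exact h.mem_functions_iff v
  fg W := by
    rw [LinearMap.range_eq_map]
    exact Module.Finite.fg_top.map _
  span_eq_top W := by
    rw [eq_top_iff, ← Ideal.span_singleton_one, Ideal.span, Submodule.span_le]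
    exact Set.singleton_subset_iff.2 (Submodule.subset_span ⟨1, by simp⟩)

@[simp]
lemma mem_sec_structureSheaf {W : AffinePatch X} {k : X.functionField} :
    k ∈ structureSheaf.sec W ↔ k ∈ W.functions := by
  exact mem_range_linearMap_functions

/-- The sheaf of families of sections. -/
noncomputable def pi (L : LatticeSheaf X V) (ι : Type*) [Finite ι] : LatticeSheaf X (ι → V) where
  sec W := Submodule.pi Set.univ fun _ => L.sec W
  mem_iff_of_isBasic {W W' f} h v := by
    simp only [Submodule.mem_pi, Set.mem_univ, true_implies, Pi.smul_apply,
      L.mem_iff_of_isBasic h]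
    refine ⟨fun hv => ?_, fun ⟨n, hn⟩ i => ⟨n, hn i⟩⟩
    choose n hn using hv
    cases nonempty_fintype ι
    refine ⟨∑ i, n i, fun i => ?_⟩
    classical
    rw [← Finset.sum_erase_add _ _ (Finset.mem_univ i), pow_add, mul_smul]
    exact L.smul_mem (pow_mem h.mem _) (hn i)
  fg W := Submodule.fg_pi fun _ => L.fg W
  span_eq_top W := by
    rw [eq_top_iff]
    rintro v -
    cases nonempty_fintype ι
    obtain ⟨d, hd, hd0, hdv⟩ := L.exists_smul_mem_finset W Finset.univ v
    rw [← inv_smul_smul₀ hd0 v]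
    exact Submodule.smul_mem _ _ (Submodule.subset_span fun i _ => hdv i (Finset.mem_univ i))

@[simp]
lemma mem_sec_pi {L : LatticeSheaf X V} {ι : Type*} [Finite ι] {W : AffinePatch X} {v : ι → V} :
    v ∈ (L.pi ι).sec W ↔ ∀ i, v i ∈ L.sec W := by
  simp [pi]

/-- The transport of a lattice sheaf along an isomorphism of vector spaces. -/
noncomputable def comap (L : LatticeSheaf X V₂) (e : V₁ ≃ₗ[X.functionField] V₂) :
    LatticeSheaf X V₁ where
  sec W := (L.sec W).comap (e.restrictScalars W.functions).toLinearMap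
  mem_iff_of_isBasic h v := by
    simpa using L.mem_iff_of_isBasic h (e v)
  fg W := by
    rw [Submodule.comap_equiv_eq_map_symm]
    exact (L.fg W).map _
  span_eq_top W := by
    rw [eq_top_iff]
    rintro v -
    obtain ⟨d, hd, hd0, hdv⟩ := L.exists_smul_mem W (e v)
    rw [← inv_smul_smul₀ hd0 v]
    refine Submodule.smul_mem _ _ (Submodule.subset_span ?_)
    simpa using hdv

@[simp]
lemma mem_sec_comap {L : LatticeSheaf X V₂} {e : V₁ ≃ₗ[X.functionField] V₂} {W : AffinePatch X}
    {v : V₁} : v ∈ (L.comap e).sec W ↔ e v ∈ L.sec W := Iff.rfl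

/-- The vectors `v` such that `β v` maps the sections of `L₂` over `W` to those of `L₃`. -/
def colonSec (β : V₁ →ₗ[X.functionField] V₂ →ₗ[X.functionField] V₃) (L₂ : LatticeSheaf X V₂)
    (L₃ : LatticeSheaf X V₃) (W : AffinePatch X) : Submodule W.functions V₁ where
  carrier := {v | ∀ w ∈ L₂.sec W, β v w ∈ L₃.sec W}
  add_mem' := fun {v v'} hv hv' w hw => by
    rw [map_add, LinearMap.add_apply]
    exact add_mem (hv w hw) (hv' w hw)
  zero_mem' := fun w _ => by
    rw [map_zero, LinearMap.zero_apply]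
    exact zero_mem _
  smul_mem' := fun r v hv w hw => by
    change β ((r : X.functionField) • v) w ∈ _
    rw [map_smul, LinearMap.smul_apply]
    exact L₃.smul_mem r.2 (hv w hw)

/-- The evaluation of the elements of `colonSec β L₂ L₃ W` at finitely many sections of `L₂`. -/
noncomputable def colonEval (β : V₁ →ₗ[X.functionField] V₂ →ₗ[X.functionField] V₃)
    (L₂ : LatticeSheaf X V₂) (L₃ : LatticeSheaf X V₃) {W : AffinePatch X} {S : Finset V₂}
    (hS : ∀ w ∈ S, w ∈ L₂.sec W) :
    colonSec β L₂ L₃ W →ₗ[W.functions] (S → L₃.sec W) where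
  toFun v w := ⟨β v w, v.2 w (hS w w.2)⟩
  map_add' v v' := by
    ext w
    simp
  map_smul' r v := by
    ext w
    change β ((r : X.functionField) • (v : V₁)) w = (r : X.functionField) • β v w
    rw [map_smul, LinearMap.smul_apply]

lemma colonEval_injective {β : V₁ →ₗ[X.functionField] V₂ →ₗ[X.functionField] V₃}
    (hβ : Function.Injective β) (L₂ : LatticeSheaf X V₂) (L₃ : LatticeSheaf X V₃)
    {W : AffinePatch X} {S : Finset V₂} (hS : ∀ w ∈ S, w ∈ L₂.sec W)
    (hS' : Submodule.span W.functions (S : Set V₂) = L₂.sec W) :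
    Function.Injective (colonEval β L₂ L₃ hS) := by
  intro v v' h
  refine Subtype.ext (hβ (LinearMap.ext_on (s := (S : Set V₂)) ?_ fun w hw =>
    congrArg Subtype.val (congrFun h ⟨w, hw⟩)))
  rw [eq_top_iff, ← L₂.span_eq_top W, Submodule.span_le, ← hS']
  exact Submodule.span_subset_span W.functions X.functionField (S : Set V₂)

/-- It suffices to test the defining condition of `colonSec` on generators. -/
lemma mem_colonSec_of_span_eq {β : V₁ →ₗ[X.functionField] V₂ →ₗ[X.functionField] V₃}
    {L₂ : LatticeSheaf X V₂} {L₃ : LatticeSheaf X V₃} {W : AffinePatch X} {S : Set V₂}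
    (hS : Submodule.span W.functions S = L₂.sec W) {v : V₁} (hv : ∀ w ∈ S, β v w ∈ L₃.sec W) :
    v ∈ colonSec β L₂ L₃ W := by
  intro w hw
  rw [← hS] at hw
  induction hw using Submodule.span_induction with
  | mem w hw => exact hv w hw
  | zero => rw [map_zero]; exact zero_mem _
  | add w w' _ _ hw hw' => rw [map_add]; exact add_mem hw hw'
  | smul r w _ hw =>
    change β _ ((r : X.functionField) • w) ∈ _
    rw [map_smul]
    exact L₃.smul_mem r.2 hw

lemma fg_colonSec [IsLocallyNoetherian X] {β : V₁ →ₗ[X.functionField] V₂ →ₗ[X.functionField] V₃}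
    (hβ : Function.Injective β) (L₂ : LatticeSheaf X V₂) (L₃ : LatticeSheaf X V₃)
    (W : AffinePatch X) : (colonSec β L₂ L₃ W).FG := by
  obtain ⟨S, hS⟩ := L₂.fg W
  have : Module.Finite W.functions (L₃.sec W) := Module.Finite.iff_fg.2 (L₃.fg W)
  rw [← Module.Finite.iff_fg]
  exact Module.Finite.of_injective _
    (colonEval_injective hβ L₂ L₃ (fun w hw => hS ▸ Submodule.subset_span hw) hS)

/-- For a bilinear map `β : V₁ × V₂ → V₃`, the sheaf of all `v` such that `β v` maps `L₂` to `L₃`.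
-/
noncomputable def colon [IsLocallyNoetherian X]
    (β : V₁ →ₗ[X.functionField] V₂ →ₗ[X.functionField] V₃)
    (hβ : Function.Injective β) (L₂ : LatticeSheaf X V₂) (L₃ : LatticeSheaf X V₃) :
    LatticeSheaf X V₁ where
  sec := colonSec β L₂ L₃
  mem_iff_of_isBasic {W W' f} h v := by
    constructor
    · intro hv
      obtain ⟨S, hS⟩ := L₂.fg W
      have hSL : ∀ w ∈ S, w ∈ L₂.sec W := fun w hw => hS ▸ Submodule.subset_span hw
      have h1 : ∀ w ∈ L₂.sec W, β v w ∈ L₃.sec W' := fun w hw =>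
        hv w (L₂.sec_anti h.le hw)
      have h2 : ∀ w : S, ∃ n : ℕ, f ^ n • β v w ∈ L₃.sec W := fun w =>
        (L₃.mem_iff_of_isBasic h _).1 (h1 w (hSL w w.2))
      choose n hn using h2
      refine ⟨∑ w, n w, mem_colonSec_of_span_eq hS fun w hw => ?_⟩
      classical
      rw [map_smul, LinearMap.smul_apply,
        ← Finset.sum_erase_add _ _ (Finset.mem_univ (⟨w, hw⟩ : S)), pow_add, mul_smul]
      exact L₃.smul_mem (pow_mem h.mem _) (hn ⟨w, hw⟩)
    · rintro ⟨n, hn⟩ w hw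
      obtain ⟨m, hm⟩ := (L₂.mem_iff_of_isBasic h w).1 hw
      refine (L₃.mem_iff_of_isBasic h _).2 ⟨m + n, ?_⟩
      have := hn _ hm
      rwa [map_smul, map_smul, LinearMap.smul_apply, smul_smul, ← pow_add] at this
  fg := fg_colonSec hβ L₂ L₃
  span_eq_top W := by
    rw [eq_top_iff]
    rintro v -
    obtain ⟨S, hS⟩ := L₂.fg W
    obtain ⟨d, hd, hd0, hdv⟩ := L₃.exists_smul_mem_finset W S fun w => β v w
    rw [← inv_smul_smul₀ hd0 v]
    refine Submodule.smul_mem _ _ (Submodule.subset_span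
      (mem_colonSec_of_span_eq hS fun w hw => ?_))
    rw [map_smul, LinearMap.smul_apply]
    exact hdv w hw

lemma mem_sec_colon [IsLocallyNoetherian X] {β : V₁ →ₗ[X.functionField] V₂ →ₗ[X.functionField] V₃}
    {hβ : Function.Injective β} {L₂ : LatticeSheaf X V₂} {L₃ : LatticeSheaf X V₃}
    {W : AffinePatch X} {v : V₁} :
    v ∈ (colon β hβ L₂ L₃).sec W ↔ ∀ w ∈ L₂.sec W, β v w ∈ L₃.sec W := Iff.rfl

end LatticeSheaf

end

/-! ### Orders as lattices -/

section

open CategoryTheory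

variable {X : Scheme.{u}} [IsIntegral X]

namespace LatticeSheaf

variable {A : Type u} [Ring A] [Algebra X.functionField A]

/-- The lattice sheaf underlying an order. -/
def ofOrder (Λ : SchemeOrder X A) : LatticeSheaf X A where
  sec W :=
    { (Λ.sections W.opens).toAddSubgroup with
      smul_mem' := by
        rintro ⟨_, s, rfl⟩ a ha
        change X.germToFunctionField W.opens s • a ∈ Λ.sections W.opens
        rw [Algebra.smul_def]
        exact mul_mem (Λ.germ_mem s) ha }
  mem_iff_of_isBasic {W W' f} h a := by
    constructor
    · obtain ⟨s, rfl, h⟩ := h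
      obtain ⟨U, hU, hU'⟩ := W'
      subst h
      intro ha
      obtain ⟨n, hn⟩ := Λ.exists_pow_mul_mem W.isAffine s ha
      refine ⟨n, ?_⟩
      rw [Algebra.smul_def, map_pow]
      exact hn
    · rintro ⟨n, hn⟩
      obtain ⟨t, ht⟩ := pow_mem h.inv_mem n
      have h1 := mul_mem (Λ.germ_mem t) (Λ.sections_anti h.le hn)
      have ht' : X.germToFunctionField W'.opens t = f⁻¹ ^ n := ht
      rw [ht', ← Algebra.smul_def, smul_smul, ← mul_pow, inv_mul_cancel₀ h.ne_zero, one_pow,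
        one_smul] at h1
      exact h1
  fg W := by
    obtain ⟨S, hS⟩ := Λ.exists_generators W.isAffine
    refine ⟨S, le_antisymm (Submodule.span_le.2 fun a ha => ?_) fun a ha => ?_⟩
    · classical
      refine (hS a).2 ⟨Pi.single a 1, ?_⟩
      rw [Finset.sum_eq_single_of_mem a ha fun b _ hb => by rw [Pi.single_eq_of_ne hb]; simp]
      simp
    · obtain ⟨c, rfl⟩ := (hS a).1 ha
      refine sum_mem fun s hs => ?_
      rw [← Algebra.smul_def]
      exact Submodule.smul_mem _ (⟨_, c s, rfl⟩ : W.functions) (Submodule.subset_span hs)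
  span_eq_top W := Λ.span_eq_top W.isAffine

@[simp]
lemma mem_sec_ofOrder {Λ : SchemeOrder X A} {W : AffinePatch X} {a : A} :
    a ∈ (ofOrder Λ).sec W ↔ a ∈ Λ.sections W.opens := Iff.rfl

lemma mem_sec_iff_forall_le (L : LatticeSheaf X A) (W : AffinePatch X) (a : A) :
    (∀ W' : AffinePatch X, W'.opens ≤ W.opens → a ∈ L.sec W') ↔ a ∈ L.sec W :=
  ⟨fun h => h W le_rfl, fun h _ hW' => L.sec_anti hW' h⟩

/-- The order given by a lattice sheaf whose modules of sections are subrings. Its sections over an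
open set `U` are the elements which are sections over all affine open subsets of `U`. -/
def toOrder (L : LatticeSheaf X A) (one_mem : ∀ W, 1 ∈ L.sec W)
    (mul_mem : ∀ W, ∀ a ∈ L.sec W, ∀ b ∈ L.sec W, a * b ∈ L.sec W) : SchemeOrder X A where
  sections U _ :=
    { carrier := {a | ∀ W : AffinePatch X, W.opens ≤ U → a ∈ L.sec W}
      mul_mem' := fun ha hb W hW => mul_mem W _ (ha W hW) _ (hb W hW)
      one_mem' := fun W _ => one_mem W
      add_mem' := fun ha hb W hW => add_mem (ha W hW) (hb W hW)
      zero_mem' := fun W _ => zero_mem _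
      neg_mem' := fun ha W hW => neg_mem (ha W hW) }
  sections_anti h _ ha W hW := ha W (hW.trans h)
  mem_of_locally {U _ a} h W hW := by
    refine L.mem_of_forall_isBasic fun x hx => ?_
    obtain ⟨V, _, hxV, -, hV⟩ := h x (hW hx)
    obtain ⟨f, hfV, hxf⟩ := W.isAffine.exists_basicOpen_le ⟨x, hxV⟩ hx
    have hne : Nonempty (X.basicOpen f) := ⟨⟨x, hxf⟩⟩
    exact ⟨W.basicOpen f, _, hxf, W.isBasic_basicOpen f, hV _ hfV⟩
  germ_mem {U _} s W hW := by
    rw [Algebra.algebraMap_eq_smul_one, ← AffinePatch.germToFunctionField_res hW]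
    exact L.smul_mem ⟨_, rfl⟩ (one_mem W)
  exists_pow_mul_mem {U _} hU f _ a ha := by
    obtain ⟨n, hn⟩ := (L.mem_iff_of_isBasic (AffinePatch.isBasic_basicOpen ⟨U, ‹_›, hU⟩ f) a).1
      (ha _ le_rfl)
    refine ⟨n, (L.mem_sec_iff_forall_le ⟨U, ‹_›, hU⟩ _).2 ?_⟩
    rwa [← map_pow, ← Algebra.smul_def]
  exists_generators {U _} hU := by
    obtain ⟨S, hS⟩ := L.fg ⟨U, ‹_›, hU⟩
    refine ⟨S, fun a => (L.mem_sec_iff_forall_le ⟨U, ‹_›, hU⟩ a).trans ?_⟩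
    rw [← hS, Submodule.mem_span_finset]
    constructor
    · rintro ⟨c, -, rfl⟩
      choose t ht using fun b : A => (c b).2
      refine ⟨t, Finset.sum_congr rfl fun b _ => ?_⟩
      rw [← Algebra.smul_def]
      exact congrArg (· • b) (ht b).symm
    · rintro ⟨c, rfl⟩
      rw [← Submodule.mem_span_finset]
      refine sum_mem fun b hb => ?_
      rw [← Algebra.smul_def]
      exact Submodule.smul_mem _ (AffinePatch.sectionsEquiv ⟨U, ‹_›, hU⟩ (c b))
        (Submodule.subset_span hb)
  span_eq_top {U _} hU := by
    rw [← L.span_eq_top ⟨U, ‹_›, hU⟩]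
    congr 1
    ext a
    exact L.mem_sec_iff_forall_le ⟨U, ‹_›, hU⟩ a

@[simp]
lemma mem_sections_toOrder {L : LatticeSheaf X A} {one_mem mul_mem} {W : AffinePatch X} {a : A} :
    a ∈ (L.toOrder one_mem mul_mem).sections W.opens ↔ a ∈ L.sec W :=
  L.mem_sec_iff_forall_le W a

end LatticeSheaf

namespace SchemeOrder

variable {A : Type u} [Ring A] [Algebra X.functionField A]

/-- The inclusion of orders can be checked on affine open sets. -/
lemma le_of_forall_affine {Λ Λ' : SchemeOrder X A}
    (h : ∀ W : AffinePatch X, Λ.sections W.opens ≤ Λ'.sections W.opens) : Λ ≤ Λ' := by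
  intro U _ a ha
  refine Λ'.mem_of_locally fun x hx => ?_
  obtain ⟨V, hV, hxV, hVU⟩ := exists_isAffineOpen_mem_and_subset hx
  have hne : Nonempty V := ⟨⟨x, hxV⟩⟩
  exact ⟨V, hne, hxV, hVU, h ⟨V, hne, hV⟩ (Λ.sections_anti hVU ha)⟩

/-- The functions on `W` act on the sections of an order over `W`. -/
noncomputable instance (Λ : SchemeOrder X A) (W : AffinePatch X) :
    Algebra W.functions (Λ.sections W.opens) :=
  ((Λ.structureMap W.opens).comp W.sectionsEquiv.symm.toRingHom).toAlgebra' fun r a =>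
    Algebra.commutes (R := Γ(X, W.opens)) (A := Λ.sections W.opens) (W.sectionsEquiv.symm r) a

@[simp]
lemma coe_algebraMap (Λ : SchemeOrder X A) (W : AffinePatch X) (r : W.functions) :
    (algebraMap W.functions (Λ.sections W.opens) r : A) =
      algebraMap X.functionField A (r : X.functionField) := by
  obtain ⟨s, rfl⟩ := W.sectionsEquiv.surjective r
  change ((Λ.structureMap W.opens) (W.sectionsEquiv.symm (W.sectionsEquiv s)) : A) = _
  rw [RingEquiv.symm_apply_apply]
  rfl

@[simp]
lemma coe_smul (Λ : SchemeOrder X A) (W : AffinePatch X) (r : W.functions)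
    (a : Λ.sections W.opens) :
    ((r • a : Λ.sections W.opens) : A) = (r : X.functionField) • (a : A) := by
  rw [Algebra.smul_def, Algebra.smul_def, Subring.coe_mul, coe_algebraMap]

/-- The Azumaya condition, in terms of the functions on affine open sets as elements of the function
field. -/
lemma isAzumaya_iff {Λ : SchemeOrder X A} :
    Λ.IsAzumaya ↔ ∀ W : AffinePatch X, _root_.IsAzumaya W.functions (Λ.sections W.opens) := by
  constructor
  · intro h W
    have := h W.opens W.isAffine
    refine IsAzumaya.of_ringEquiv W.sectionsEquiv fun s => Subtype.ext ?_
    rw [coe_algebraMap]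
    rfl
  · intro h U _ hU
    obtain ⟨W, rfl⟩ : ∃ W : AffinePatch X, W.opens = U := ⟨⟨U, ‹_›, hU⟩, rfl⟩
    have := h W
    exact IsAzumaya.of_ringEquiv (R := W.functions) (S := Γ(X, W.opens))
      (A := Λ.sections W.opens) W.sectionsEquiv.symm fun s => rfl

end SchemeOrder

namespace AffinePatch

lemma ringKrullDim_functions_le (W : AffinePatch X) :
    ringKrullDim W.functions ≤ topologicalKrullDim X := by
  rw [← ringKrullDim_eq_of_ringEquiv W.sectionsEquiv,
    ← PrimeSpectrum.topologicalKrullDim_eq_ringKrullDim Γ(X, W.opens)]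
  change topologicalKrullDim (Spec Γ(X, W.opens)) ≤ _
  rw [← IsHomeomorph.topologicalKrullDim_eq _ W.isAffine.isoSpec.hom.homeomorph.isHomeomorph]
  exact topologicalKrullDim_subspace_le X W.opens

variable (W : AffinePatch X)

lemma _root_.IsLocalization.AtPrime.exists_of_ringEquiv {R R' S : Type*} [CommRing R] [CommRing R']
    [CommRing S] [Algebra R S] (e : R ≃+* R') (q : Ideal R) [q.IsPrime] [IsLocalization.AtPrime S q]
    (p : Ideal R') [p.IsPrime] (h : ∀ r, r ∈ q ↔ e r ∈ p) :
    ∃ _ : Algebra R' S, IsLocalization.AtPrime S p := by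
  refine ⟨((algebraMap R S).comp e.symm.toRingHom).toAlgebra, ?_⟩
  have h1 := IsLocalization.isLocalization_of_base_ringEquiv q.primeCompl S e
  have h2 : q.primeCompl.map e = p.primeCompl := by
    ext r
    constructor
    · rintro ⟨r, hr, rfl⟩
      exact fun hr' => hr ((h r).2 hr')
    · intro hr
      refine ⟨e.symm r, fun hr' => hr ?_, e.apply_symm_apply r⟩
      rw [← e.apply_symm_apply r]
      exact (h _).1 hr'
  rw [h2] at h1
  exact h1

/-- The stalk at a point of `W` is a localization of the ring of functions. -/
lemma exists_isLocalization_stalk {x : X} (hx : x ∈ W.opens) :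
    ∃ (p : Ideal W.functions) (_ : p.IsPrime) (_ : Algebra W.functions (X.presheaf.stalk x)),
      IsLocalization.AtPrime (X.presheaf.stalk x) p := by
  let := TopCat.Presheaf.algebra_section_stalk X.presheaf (⟨x, hx⟩ : W.opens)
  have := W.isAffine.isLocalization_stalk ⟨x, hx⟩
  refine ⟨(W.isAffine.primeIdealOf ⟨x, hx⟩).asIdeal.comap W.sectionsEquiv.symm.toRingHom,
    inferInstance, ?_⟩
  exact IsLocalization.AtPrime.exists_of_ringEquiv W.sectionsEquiv
    (W.isAffine.primeIdealOf ⟨x, hx⟩).asIdeal _ fun r => by simp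

/-- The localizations of the ring of functions on `W` are stalks. -/
lemma exists_stalk_ringEquiv_localization (p : Ideal W.functions) [p.IsPrime] :
    ∃ x : X, Nonempty (X.presheaf.stalk x ≃+* Localization.AtPrime p) := by
  let y : PrimeSpectrum Γ(X, W.opens) := ⟨p.comap W.sectionsEquiv.toRingHom, inferInstance⟩
  have hy : W.isAffine.fromSpec y ∈ W.opens := by
    rw [← SetLike.mem_coe, ← W.isAffine.range_fromSpec]
    exact Set.mem_range_self y
  let := TopCat.Presheaf.algebra_section_stalk X.presheaf
    (⟨W.isAffine.fromSpec y, hy⟩ : W.opens)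
  have := W.isAffine.isLocalization_stalk' y hy
  obtain ⟨_, _⟩ := @IsLocalization.AtPrime.exists_of_ringEquiv _ _
    (X.presheaf.stalk (W.isAffine.fromSpec y)) _ _ _
    (TopCat.Presheaf.algebra_section_stalk X.presheaf ⟨_, hy⟩) W.sectionsEquiv y.asIdeal _ this p _
    fun r => Iff.rfl
  exact ⟨W.isAffine.fromSpec y, ⟨(IsLocalization.algEquiv p.primeCompl
    (X.presheaf.stalk (W.isAffine.fromSpec y)) (Localization.AtPrime p)).toRingEquiv⟩⟩

lemma exists_mem {X : Scheme.{u}} (x : X) : ∃ W : AffinePatch X, x ∈ W.opens := by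
  obtain ⟨V, hV, hxV, -⟩ := exists_isAffineOpen_mem_and_subset (TopologicalSpace.Opens.mem_top x)
  exact ⟨⟨V, ⟨⟨x, hxV⟩⟩, hV⟩, hxV⟩

/-- The rings of functions of a regular scheme of dimension at most two are regular, and the
dimension of their localizations is at most two. -/
lemma isRegularLocalRing_localization (hX : IsRegularScheme X) (hdim : topologicalKrullDim X ≤ 2)
    (p : Ideal W.functions) [p.IsPrime] :
    IsRegularLocalRing (Localization.AtPrime p) ∧ ringKrullDim (Localization.AtPrime p) ≤ 2 := by
  obtain ⟨x, ⟨e⟩⟩ := W.exists_stalk_ringEquiv_localization p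
  have := hX x
  refine ⟨IsRegularLocalRing.of_ringEquiv e, ?_⟩
  rw [IsLocalization.AtPrime.ringKrullDim_eq_height p]
  exact (Ideal.height_le_ringKrullDim_of_ne_top Ideal.IsPrime.ne_top').trans
    (W.ringKrullDim_functions_le.trans hdim)

end AffinePatch

end

/-! ### Maximal orders over regular schemes -/

section

open MulOpposite

variable {X : Scheme.{u}} [IsIntegral X]

/-- Over a regular scheme of dimension at most two, the sheaf of homomorphisms from a lattice to
a locally free lattice is locally free. -/
lemma LatticeSheaf.projective_colon [IsLocallyNoetherian X] (hX : IsRegularScheme X)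
    (hdim : topologicalKrullDim X ≤ 2) {V₁ V₂ V₃ : Type*}
    [AddCommGroup V₁] [Module X.functionField V₁] [AddCommGroup V₂] [Module X.functionField V₂]
    [AddCommGroup V₃] [Module X.functionField V₃]
    (β : V₁ →ₗ[X.functionField] V₂ →ₗ[X.functionField] V₃) (hβ : Function.Injective β)
    (L₂ : LatticeSheaf X V₂) (L₃ : LatticeSheaf X V₃) (W : AffinePatch X)
    [Module.Projective W.functions (L₃.sec W)] :
    Module.Projective W.functions ((colon β hβ L₂ L₃).sec W) := by
  obtain ⟨S, hS⟩ := L₂.fg W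
  have hSL : ∀ w ∈ S, w ∈ L₂.sec W := fun w hw => hS ▸ Submodule.subset_span hw
  have : Module.Finite W.functions (L₃.sec W) := Module.Finite.iff_fg.2 (L₃.fg W)
  have : Module.Projective W.functions (S → L₃.sec W) :=
    Module.Projective.of_equiv (DFinsupp.linearEquivFunOnFintype (R := W.functions)
      (M := fun _ : S => L₃.sec W))
  have : Module.Projective W.functions (LinearMap.range (colonEval β L₂ L₃ hSL)) := by
    refine Module.projective_of_saturated
      (fun p _ => W.isRegularLocalRing_localization hX hdim p) _ fun r g hr => ?_
    rintro ⟨v, hv⟩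
    have hr' : (r : X.functionField) ≠ 0 := fun h => hr (Subtype.ext h)
    -- `v / r` lies in the colon module as well
    have h1 : ∀ w : S, β ((r : X.functionField)⁻¹ • (v : V₁)) w = g w := by
      intro w
      have h2 : β v w = (r : X.functionField) • (g w : V₃) :=
        congrArg Subtype.val (congrFun hv w)
      rw [map_smul, LinearMap.smul_apply, h2, inv_smul_smul₀ hr']
    refine ⟨⟨(r : X.functionField)⁻¹ • (v : V₁), mem_colonSec_of_span_eq hS fun w hw => ?_⟩, ?_⟩
    · rw [h1 ⟨w, hw⟩]
      exact (g _).2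
    · ext w
      exact h1 w
  exact Module.Projective.of_equiv
    (LinearEquiv.ofInjective _ (colonEval_injective hβ L₂ L₃ hSL hS)).symm

section Connecting

variable {ι κ : Type}
  {A B : Type u} [Ring A] [Algebra X.functionField A] [Ring B] [Algebra X.functionField B]

open LatticeSheaf

variable (X ι A) in
/-- The product of a column `w` and a row `v`, as a bilinear map in `v` and `w`. -/
noncomputable def columnRow :
    (ι → A) →ₗ[X.functionField] (ι → A) →ₗ[X.functionField] Matrix ι ι A :=
  LinearMap.mk₂ X.functionField (fun v w => Matrix.vecMulVec w v)
    (fun v v' w => Matrix.vecMulVec_add w v v') (fun k v w => Matrix.vecMulVec_smul k w v)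
    (fun v w w' => Matrix.add_vecMulVec w w' v) (fun k v w => Matrix.smul_vecMulVec k w v)

@[simp]
lemma columnRow_apply (v w : ι → A) : columnRow X ι A v w = Matrix.vecMulVec w v := rfl

lemma columnRow_injective : Function.Injective (columnRow X ι A) := by
  intro v v' h
  ext i
  have := congrFun (congrFun (LinearMap.congr_fun h 1) i) i
  simpa [Matrix.vecMulVec_apply] using this

variable (X ι A) in
/-- The action of `A` on `ι → A` by left multiplication. -/
noncomputable def leftMul : A →ₗ[X.functionField] (ι → A) →ₗ[X.functionField] (ι → A) :=
  LinearMap.mk₂ X.functionField (fun a v => a • v) (fun a b v => add_smul a b v)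
    (fun k a v => smul_assoc k a v) (fun a v w => smul_add a v w) (fun k a v => smul_comm a k v)

lemma leftMul_injective [Nonempty ι] : Function.Injective (leftMul X ι A) := by
  intro a b h
  obtain ⟨i⟩ := ‹Nonempty ι›
  simpa [leftMul] using congrFun (LinearMap.congr_fun h 1) i

variable [Fintype ι] [DecidableEq ι] [Fintype κ] [DecidableEq κ]
  (ψ : Matrix ι ι A ≃ₐ[X.functionField] Matrix κ κ B)
  (Λ : SchemeOrder X A) (Λ' : SchemeOrder X B)

/-- The lattice in `Matrix ι ι A` which corresponds to the matrices with entries in the order `Λ'`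
under the isomorphism `ψ`. -/
noncomputable def matrixLattice : LatticeSheaf X (Matrix ι ι A) :=
  (((ofOrder Λ').pi κ).pi κ).comap
    (ψ.toLinearEquiv.trans (Matrix.ofLinearEquiv X.functionField).symm)

lemma mem_sec_matrixLattice {W : AffinePatch X} {c : Matrix ι ι A} :
    c ∈ (matrixLattice ψ Λ').sec W ↔ ∀ i j, ψ c i j ∈ Λ'.sections W.opens := by
  simp only [matrixLattice, mem_sec_comap, mem_sec_pi, mem_sec_ofOrder]
  rfl

lemma mul_mem_matrixLattice {W : AffinePatch X} {c d : Matrix ι ι A}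
    (hc : c ∈ (matrixLattice ψ Λ').sec W) (hd : d ∈ (matrixLattice ψ Λ').sec W) :
    c * d ∈ (matrixLattice ψ Λ').sec W := by
  rw [mem_sec_matrixLattice] at *
  intro i j
  rw [map_mul, Matrix.mul_apply]
  exact sum_mem fun k _ => mul_mem (hc i k) (hd k j)

/-- The ring of matrices with entries in `Λ'` as a subring of `Matrix ι ι A`. -/
noncomputable def matrixEmbedding (W : AffinePatch X) :
    Matrix κ κ (Λ'.sections W.opens) →+* Matrix ι ι A :=
  ψ.symm.toRingHom.comp (Λ'.sections W.opens).subtype.mapMatrix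

lemma apply_matrixEmbedding (W : AffinePatch X) (c : Matrix κ κ (Λ'.sections W.opens)) :
    ψ (matrixEmbedding ψ Λ' W c) = c.map (↑) :=
  ψ.apply_symm_apply _

lemma matrixEmbedding_mem (W : AffinePatch X) (c : Matrix κ κ (Λ'.sections W.opens)) :
    matrixEmbedding ψ Λ' W c ∈ (matrixLattice ψ Λ').sec W := by
  rw [mem_sec_matrixLattice, apply_matrixEmbedding]
  exact fun i j => (c i j).2

lemma exists_matrixEmbedding_eq {W : AffinePatch X} {c : Matrix ι ι A}
    (hc : c ∈ (matrixLattice ψ Λ').sec W) : ∃ d, matrixEmbedding ψ Λ' W d = c := by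
  rw [mem_sec_matrixLattice] at hc
  refine ⟨Matrix.of fun i j => ⟨_, hc i j⟩, ψ.injective ?_⟩
  rw [apply_matrixEmbedding]
  rfl

lemma matrixEmbedding_algebraMap (W : AffinePatch X) (r : W.functions) :
    matrixEmbedding ψ Λ' W (algebraMap _ _ r) =
      algebraMap X.functionField _ (r : X.functionField) := by
  apply ψ.injective
  rw [apply_matrixEmbedding, AlgEquiv.commutes]
  ext i j
  simp only [Matrix.map_apply, Matrix.algebraMap_matrix_apply]
  split_ifs
  · simp
  · simp

/-- The ring of matrices with entries in `Λ'` is isomorphic to `matrixLattice ψ Λ'`. -/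
noncomputable def matrixLatticeEquiv (W : AffinePatch X) :
    Matrix κ κ (Λ'.sections W.opens) ≃ₗ[W.functions] (matrixLattice ψ Λ').sec W :=
  LinearEquiv.ofBijective
    { toFun := fun c => ⟨matrixEmbedding ψ Λ' W c, matrixEmbedding_mem ψ Λ' W c⟩
      map_add' := fun c d => Subtype.ext (map_add _ c d)
      map_smul' := fun r c => Subtype.ext (by
        change matrixEmbedding ψ Λ' W (r • c) = (r : X.functionField) • matrixEmbedding ψ Λ' W c
        rw [Algebra.smul_def, map_mul, matrixEmbedding_algebraMap, ← Algebra.smul_def]) }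
    ⟨fun c d h => by
      have h := congrArg ψ (congrArg Subtype.val h)
      simp only [LinearMap.coe_mk, AddHom.coe_mk, apply_matrixEmbedding] at h
      ext i j
      exact congrFun (congrFun h i) j, fun c => by
      obtain ⟨d, hd⟩ := exists_matrixEmbedding_eq ψ Λ' c.2
      exact ⟨d, Subtype.ext hd⟩⟩

variable [IsLocallyNoetherian X]

/-- The bimodule connecting `Λ` and the order of matrices over `Λ'`: the row vectors `v` such that
`w v` lies in `matrixLattice ψ Λ'` for all column vectors `w` over `Λ`. -/
noncomputable def connecting : LatticeSheaf X (ι → A) :=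
  colon (columnRow X ι A) columnRow_injective ((ofOrder Λ).pi ι) (matrixLattice ψ Λ')

lemma mem_sec_connecting {W : AffinePatch X} {v : ι → A} :
    v ∈ (connecting ψ Λ Λ').sec W ↔ ∀ w : ι → A, (∀ i, w i ∈ Λ.sections W.opens) →
      Matrix.vecMulVec w v ∈ (matrixLattice ψ Λ').sec W := by
  simp [connecting, mem_sec_colon]

lemma vecMul_mem_connecting {W : AffinePatch X} {v : ι → A}
    (hv : v ∈ (connecting ψ Λ Λ').sec W) {c : Matrix ι ι A}
    (hc : c ∈ (matrixLattice ψ Λ').sec W) : Matrix.vecMul v c ∈ (connecting ψ Λ Λ').sec W := by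
  rw [mem_sec_connecting] at hv ⊢
  intro w hw
  rw [← Matrix.vecMulVec_mul]
  exact mul_mem_matrixLattice ψ Λ' (hv w hw) hc

lemma smul_mem_connecting {W : AffinePatch X} {v : ι → A}
    (hv : v ∈ (connecting ψ Λ Λ').sec W) {a : A} (ha : a ∈ Λ.sections W.opens) :
    a • v ∈ (connecting ψ Λ Λ').sec W := by
  rw [mem_sec_connecting] at hv ⊢
  intro w hw
  have : Matrix.vecMulVec w (a • v) = Matrix.vecMulVec (fun i => w i * a) v := by
    ext i j
    simp [Matrix.vecMulVec_apply, mul_assoc]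
  rw [this]
  exact hv _ fun i => mul_mem (hw i) ha

/-- The right multiplication by a matrix with entries in `Λ'` on the connecting bimodule. -/
noncomputable def connectingMul (W : AffinePatch X) (c : Matrix κ κ (Λ'.sections W.opens)) :
    Module.End W.functions ((connecting ψ Λ Λ').sec W) where
  toFun v := ⟨Matrix.vecMul (v : ι → A) (matrixEmbedding ψ Λ' W c),
    vecMul_mem_connecting ψ Λ Λ' v.2 (matrixEmbedding_mem ψ Λ' W c)⟩
  map_add' v v' := by
    refine Subtype.ext ?_
    change Matrix.vecMul ((v : ι → A) + (v' : ι → A)) _ =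
      Matrix.vecMul (v : ι → A) _ + Matrix.vecMul (v' : ι → A) _
    exact Matrix.add_vecMul _ _ _
  map_smul' r v := by
    refine Subtype.ext ?_
    change Matrix.vecMul ((r : X.functionField) • (v : ι → A)) _ =
      (r : X.functionField) • Matrix.vecMul (v : ι → A) _
    exact Matrix.smul_vecMul _ _ _

lemma coe_connectingMul (W : AffinePatch X) (c : Matrix κ κ (Λ'.sections W.opens))
    (v : (connecting ψ Λ Λ').sec W) :
    (connectingMul ψ Λ Λ' W c v : ι → A) =
      Matrix.vecMul (v : ι → A) (matrixEmbedding ψ Λ' W c) := rfl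

/-- The right action of the matrices with entries in `Λ'` on the connecting bimodule. -/
noncomputable def connectingAction (W : AffinePatch X) :
    (Matrix κ κ (Λ'.sections W.opens))ᵐᵒᵖ →ₐ[W.functions]
      Module.End W.functions ((connecting ψ Λ Λ').sec W) :=
  AlgHom.ofLinearMap
    { toFun := fun c => connectingMul ψ Λ Λ' W c.unop
      map_add' := fun c d => by
        refine LinearMap.ext fun v => Subtype.ext ?_
        rw [unop_add, coe_connectingMul, map_add, Matrix.vecMul_add]
        rfl
      map_smul' := fun r c => by
        refine LinearMap.ext fun v => Subtype.ext ?_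
        rw [unop_smul, coe_connectingMul, Algebra.smul_def, map_mul, matrixEmbedding_algebraMap,
          ← Algebra.smul_def, Matrix.vecMul_smul]
        rfl }
    (by
      refine LinearMap.ext fun v => Subtype.ext ?_
      change Matrix.vecMul (v : ι → A) (matrixEmbedding ψ Λ' W 1) = v
      rw [map_one, Matrix.vecMul_one])
    (fun c d => by
      refine LinearMap.ext fun v => Subtype.ext ?_
      change Matrix.vecMul (v : ι → A) (matrixEmbedding ψ Λ' W (d.unop * c.unop)) =
        Matrix.vecMul (Matrix.vecMul (v : ι → A) (matrixEmbedding ψ Λ' W d.unop))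
          (matrixEmbedding ψ Λ' W c.unop)
      rw [map_mul, Matrix.vecMul_vecMul])

lemma coe_connectingAction (W : AffinePatch X) (c : Matrix κ κ (Λ'.sections W.opens))
    (v : (connecting ψ Λ Λ').sec W) :
    (connectingAction ψ Λ Λ' W (op c) v : ι → A) =
      Matrix.vecMul (v : ι → A) (matrixEmbedding ψ Λ' W c) := rfl

/-- The left multiplication by a section of `Λ` on the connecting bimodule. -/
noncomputable def connectingLeftMul (W : AffinePatch X) (a : Λ.sections W.opens) :
    Module.End W.functions ((connecting ψ Λ Λ').sec W) where
  toFun v := ⟨(a : A) • (v : ι → A), smul_mem_connecting ψ Λ Λ' v.2 a.2⟩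
  map_add' v v' := by
    refine Subtype.ext ?_
    change (a : A) • ((v : ι → A) + (v' : ι → A)) = (a : A) • (v : ι → A) + (a : A) • (v' : ι → A)
    exact smul_add _ _ _
  map_smul' r v := by
    refine Subtype.ext ?_
    change (a : A) • (r : X.functionField) • (v : ι → A) =
      (r : X.functionField) • (a : A) • (v : ι → A)
    exact smul_comm _ _ _

lemma coe_connectingLeftMul (W : AffinePatch X) (a : Λ.sections W.opens)
    (v : (connecting ψ Λ Λ').sec W) :
    (connectingLeftMul ψ Λ Λ' W a v : ι → A) = (a : A) • (v : ι → A) := rfl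

lemma connectingLeftMul_mem_commutant (W : AffinePatch X) (a : Λ.sections W.opens) :
    connectingLeftMul ψ Λ Λ' W a ∈ commutant (connectingAction ψ Λ Λ' W) := by
  refine (mem_commutant _).2 fun c => LinearMap.ext fun v => Subtype.ext ?_
  rw [Module.End.mul_apply, Module.End.mul_apply, coe_connectingAction, coe_connectingLeftMul,
    coe_connectingLeftMul, coe_connectingAction, Matrix.smul_vecMul]

/-- The map from `Λ` to the commutant of the right action on the connecting bimodule. -/
noncomputable def connectingHom (W : AffinePatch X) :
    Λ.sections W.opens →ₐ[W.functions] commutant (connectingAction ψ Λ Λ' W) :=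
  AlgHom.ofLinearMap
    { toFun := fun a =>
        ⟨connectingLeftMul ψ Λ Λ' W a, connectingLeftMul_mem_commutant ψ Λ Λ' W a⟩
      map_add' := fun a b => by
        refine Subtype.ext (LinearMap.ext fun v => Subtype.ext ?_)
        change ((a : A) + (b : A)) • (v : ι → A) = (a : A) • (v : ι → A) + (b : A) • (v : ι → A)
        exact add_smul _ _ _
      map_smul' := fun r a => by
        refine Subtype.ext (LinearMap.ext fun v => Subtype.ext ?_)
        change ((r • a : Λ.sections W.opens) : A) • (v : ι → A) =
          (r : X.functionField) • (a : A) • (v : ι → A)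
        rw [SchemeOrder.coe_smul, smul_assoc] }
    (by
      refine Subtype.ext (LinearMap.ext fun v => Subtype.ext ?_)
      change (1 : A) • (v : ι → A) = v
      exact one_smul _ _)
    (fun a b => by
      refine Subtype.ext (LinearMap.ext fun v => Subtype.ext ?_)
      change ((a : A) * (b : A)) • (v : ι → A) = (a : A) • (b : A) • (v : ι → A)
      exact mul_smul _ _ _)

lemma coe_connectingHom (W : AffinePatch X) (a : Λ.sections W.opens)
    (v : (connecting ψ Λ Λ').sec W) :
    ((connectingHom ψ Λ Λ' W a).1 v : ι → A) = (a : A) • (v : ι → A) := rfl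

variable [Nonempty ι]

/-- A maximal order is the left order of the connecting bimodule. -/
lemma mem_of_forall_smul_mem_connecting {Λ : SchemeOrder X A} (hΛ : Λ.IsMaximal)
    {W : AffinePatch X} {a : A}
    (ha : ∀ v ∈ (connecting ψ Λ Λ').sec W, a • v ∈ (connecting ψ Λ Λ').sec W) :
    a ∈ Λ.sections W.opens := by
  let L : LatticeSheaf X A :=
    colon (leftMul X ι A) leftMul_injective (connecting ψ Λ Λ') (connecting ψ Λ Λ')
  let O : SchemeOrder X A := L.toOrder
    (fun W v hv => by
      change (1 : A) • v ∈ _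
      rwa [one_smul])
    (fun W a ha b hb v hv => by
      change (a * b) • v ∈ _
      rw [mul_smul]
      exact ha _ (hb v hv))
  have h1 : Λ ≤ O := SchemeOrder.le_of_forall_affine fun W b hb =>
    mem_sections_toOrder.2 fun v hv => smul_mem_connecting ψ Λ Λ' hv hb
  exact hΛ h1 W.opens (mem_sections_toOrder.2 ha)

/-- The endomorphisms of the connecting bimodule commuting with the right action are the left
multiplications by elements of `A`. -/
lemma exists_eq_smul_of_mem_commutant {W : AffinePatch X}
    {g : Module.End W.functions ((connecting ψ Λ Λ').sec W)}
    (hg : g ∈ commutant (connectingAction ψ Λ Λ' W)) :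
    ∃ a : A, ∀ v, (g v : ι → A) = a • (v : ι → A) := by
  classical
  obtain ⟨i⟩ := ‹Nonempty ι›
  obtain ⟨d, hd, hd0, hdv⟩ := (connecting ψ Λ Λ').exists_smul_mem W (Pi.single i 1)
  let u : (connecting ψ Λ Λ').sec W := ⟨_, hdv⟩
  refine ⟨d⁻¹ • (g u : ι → A) i, fun v => ?_⟩
  -- the matrix with `i`-th row `v` and zeros elsewhere maps the `i`-th unit vector to `v`
  let c : Matrix ι ι A := Matrix.vecMulVec (Pi.single i 1) v
  obtain ⟨e, he, he0, hec⟩ := (matrixLattice ψ Λ').exists_smul_mem W c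
  obtain ⟨c', hc'⟩ := exists_matrixEmbedding_eq ψ Λ' hec
  have hc (w : ι → A) : Matrix.vecMul w c = w i • (v : ι → A) := by
    ext j
    simp [c, Matrix.vecMul, dotProduct, Matrix.vecMulVec_apply, Pi.single_apply]
  have h1 : ∀ w : (connecting ψ Λ Λ').sec W,
      (connectingAction ψ Λ Λ' W (op c') w : ι → A) = e • (w : ι → A) i • (v : ι → A) := by
    intro w
    rw [coe_connectingAction, hc', Matrix.vecMul_smul, hc]
  have h2 := congrArg Subtype.val (LinearMap.congr_fun ((mem_commutant _).1 hg c') u)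
  have h3 : connectingAction ψ Λ Λ' W (op c') u = ((⟨e, he⟩ * ⟨d, hd⟩ : W.functions)) • v := by
    refine Subtype.ext ?_
    rw [h1]
    change e • (d • Pi.single i (1 : A) : ι → A) i • (v : ι → A) = (e * d) • (v : ι → A)
    rw [Pi.smul_apply, Pi.single_eq_same, smul_assoc, one_smul, mul_smul]
  rw [Module.End.mul_apply, Module.End.mul_apply, h1, h3, map_smul] at h2
  change _ = (e * d) • (g v : ι → A) at h2
  rw [mul_smul] at h2
  have h4 := smul_right_injective _ he0 h2
  rw [smul_assoc, h4, inv_smul_smul₀ hd0]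

lemma connectingHom_injective (W : AffinePatch X) :
    Function.Injective (connectingHom ψ Λ Λ' W) := by
  classical
  obtain ⟨i⟩ := ‹Nonempty ι›
  obtain ⟨d, hd, hd0, hdv⟩ := (connecting ψ Λ Λ').exists_smul_mem W (Pi.single i 1)
  intro a b h
  have h1 := coe_connectingHom ψ Λ Λ' W a ⟨_, hdv⟩
  rw [h, coe_connectingHom] at h1
  have h2 := congrFun h1 i
  simp only [Pi.smul_apply, Pi.single_eq_same, smul_eq_mul, mul_smul_comm, mul_one] at h2
  exact Subtype.ext (smul_right_injective _ hd0 h2).symm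

lemma connectingHom_surjective (hΛ : Λ.IsMaximal) (W : AffinePatch X) :
    Function.Surjective (connectingHom ψ Λ Λ' W) := by
  rintro ⟨g, hg⟩
  obtain ⟨a, ha⟩ := exists_eq_smul_of_mem_commutant ψ Λ Λ' hg
  refine ⟨⟨a, mem_of_forall_smul_mem_connecting ψ Λ' hΛ fun v hv => ?_⟩, ?_⟩
  · rw [← ha ⟨v, hv⟩]
    exact (g _).2
  · refine Subtype.ext (LinearMap.ext fun v => Subtype.ext ?_)
    exact (ha v).symm

lemma faithfulSMul_connecting [Nontrivial A] (W : AffinePatch X) :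
    FaithfulSMul W.functions ((connecting ψ Λ Λ').sec W) := by
  classical
  obtain ⟨i⟩ := ‹Nonempty ι›
  obtain ⟨d, hd, hd0, hdv⟩ := (connecting ψ Λ Λ').exists_smul_mem W (Pi.single i 1)
  refine ⟨fun {r s} h => Subtype.ext ?_⟩
  have h1 : (r : X.functionField) • d • (Pi.single i 1 : ι → A) =
    (s : X.functionField) • d • (Pi.single i 1 : ι → A) := congrArg Subtype.val (h ⟨_, hdv⟩)
  refine smul_left_injective _ (smul_ne_zero hd0 ?_) h1
  exact fun h0 => one_ne_zero (α := A) (by simpa using congrFun h0 i)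

/-- A maximal order over a regular scheme of dimension at most two is Azumaya if it is Morita
related to an Azumaya order. -/
lemma isAzumaya_of_isMaximal [Nontrivial A] [Nonempty κ]
    (ψ : Matrix ι ι A ≃ₐ[X.functionField] Matrix κ κ B)
    (hX : IsRegularScheme X) (hdim : topologicalKrullDim X ≤ 2)
    {Λ : SchemeOrder X A} (hΛ : Λ.IsMaximal) {Λ' : SchemeOrder X B} (hΛ' : Λ'.IsAzumaya) :
    Λ.IsAzumaya := by
  rw [SchemeOrder.isAzumaya_iff] at hΛ' ⊢
  intro W
  have := hΛ' W
  have : IsAzumaya W.functions (Matrix κ κ (Λ'.sections W.opens)) := IsAzumaya.matrix_of_isAzumaya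
  have : Module.Projective W.functions ((matrixLattice ψ Λ').sec W) :=
    Module.Projective.of_equiv (matrixLatticeEquiv ψ Λ' W)
  have : Module.Projective W.functions ((connecting ψ Λ Λ').sec W) :=
    projective_colon hX hdim _ _ _ _ W
  have : Module.Finite W.functions ((connecting ψ Λ Λ').sec W) :=
    Module.Finite.iff_fg.2 ((connecting ψ Λ Λ').fg W)
  have := faithfulSMul_connecting ψ Λ Λ' W
  exact isAzumaya_of_bijective_commutant _ (connectingHom ψ Λ Λ' W)
    ⟨connectingHom_injective ψ Λ Λ' W, connectingHom_surjective ψ Λ Λ' hΛ W⟩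

end Connecting

/-- Over a regular scheme of dimension at most two, maximal orders in algebras with unramified
Brauer class are Azumaya. -/
theorem isAzumaya_of_hasUnramifiedBrauerClass [IsLocallyNoetherian X] (hX : IsRegularScheme X)
    (hdim : topologicalKrullDim X ≤ 2) {A : CSA.{u, u} X.functionField}
    (hA : HasUnramifiedBrauerClass X A) {Λ : SchemeOrder X A} (hΛ : Λ.IsMaximal) :
    Λ.IsAzumaya := by
  obtain ⟨B, Λ', hΛ', n, m, hn, hm, ⟨ψ⟩⟩ := hA
  have : Nonempty (Fin n) := ⟨⟨0, Nat.pos_of_ne_zero hn⟩⟩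
  have : Nonempty (Fin m) := ⟨⟨0, Nat.pos_of_ne_zero hm⟩⟩
  exact isAzumaya_of_isMaximal ψ hX hdim hΛ hΛ'

end

/-! ### The structure sheaf and the normalization as orders -/

section

variable {X : Scheme.{u}} [IsIntegral X]

namespace SchemeOrder

lemma isIntegral_of_smul_mem {V : Type*} [AddCommGroup V] [Module X.functionField V]
    {W : AffinePatch X} {N : Submodule W.functions V} (hN : N.FG) {v : V} (hv : v ∈ N) (hv0 : v ≠ 0)
    {t : X.functionField} (ht : ∀ w ∈ N, t • w ∈ N) : _root_.IsIntegral W.functions t :=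
  isIntegral_of_smul_mem_submodule N (fun h => hv0 (by simpa [h] using hv)) hN t ht

/-- An order is maximal if every order containing it has the same sections over the affine open
sets. -/
lemma isMaximal_of_forall_affine {A : Type u} [Ring A] [Algebra X.functionField A]
    {Λ : SchemeOrder X A} (h : ∀ Λ' : SchemeOrder X A, Λ ≤ Λ' →
      ∀ W : AffinePatch X, Λ'.sections W.opens ≤ Λ.sections W.opens) : Λ.IsMaximal :=
  fun Λ' hΛ' => le_of_forall_affine (h Λ' hΛ')

end SchemeOrder

open LatticeSheaf

variable (X) in
/-- The structure sheaf as an order in the function field. -/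
noncomputable def structureOrder : SchemeOrder X X.functionField :=
  (structureSheaf (X := X)).toOrder (fun W => by simp) fun W a ha b hb => by
    rw [mem_sec_structureSheaf] at *
    exact mul_mem ha hb

lemma mem_structureOrder {W : AffinePatch X} {a : X.functionField} :
    a ∈ (structureOrder X).sections W.opens ↔ a ∈ W.functions := by
  rw [structureOrder, mem_sections_toOrder, mem_sec_structureSheaf]

lemma structureOrder_isAzumaya : (structureOrder X).IsAzumaya := by
  rw [SchemeOrder.isAzumaya_iff]
  intro W
  refine IsAzumaya.of_bijective_algebraMap ⟨fun r s h => ?_, fun a => ?_⟩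
  · have h := congrArg Subtype.val h
    rw [SchemeOrder.coe_algebraMap, SchemeOrder.coe_algebraMap] at h
    exact Subtype.ext h
  · refine ⟨⟨a, mem_structureOrder.1 a.2⟩, Subtype.ext ?_⟩
    rw [SchemeOrder.coe_algebraMap]
    rfl

/-- The function field as a central simple algebra. -/
noncomputable def trivialCSA (K : Type u) [Field K] : CSA.{u, u} K where
  toAlgCat := AlgCat.of K K
  isCentral := inferInstanceAs (Algebra.IsCentral K K)
  isSimple := inferInstanceAs (IsSimpleRing K)
  fin_dim := inferInstanceAs (FiniteDimensional K K)

/-- A matrix algebra as a central simple algebra. -/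
noncomputable def matrixCSA (K : Type u) [Field K] (n : ℕ) [NeZero n] : CSA.{u, u} K where
  toAlgCat := AlgCat.of K (Matrix (Fin n) (Fin n) K)
  isCentral := inferInstanceAs (Algebra.IsCentral K (Matrix (Fin n) (Fin n) K))
  isSimple := inferInstanceAs (IsSimpleRing (Matrix (Fin n) (Fin n) K))
  fin_dim := inferInstanceAs (FiniteDimensional K (Matrix (Fin n) (Fin n) K))

lemma hasUnramifiedBrauerClass_trivialCSA :
    HasUnramifiedBrauerClass X (trivialCSA X.functionField) :=
  ⟨trivialCSA _, structureOrder X, structureOrder_isAzumaya, IsBrauerEquivalent.refl _⟩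

lemma hasUnramifiedBrauerClass_matrixCSA (n : ℕ) [NeZero n] :
    HasUnramifiedBrauerClass X (matrixCSA X.functionField n) :=
  ⟨trivialCSA _, structureOrder X, structureOrder_isAzumaya, 1, n, one_ne_zero, NeZero.ne n,
    ⟨by
      have e := Matrix.uniqueAlgEquiv (m := Fin 1) (R := X.functionField)
        (A := Matrix (Fin n) (Fin n) X.functionField)
      rw [Subsingleton.elim (fun a b : Fin 1 => decidableEq_of_subsingleton a b)
        (instDecidableEqFin 1)] at e
      exact e⟩⟩

section Normalization

lemma isIntegral_functions_iff {W : AffinePatch X} {t : X.functionField} :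
    _root_.IsIntegral W.functions t ↔ _root_.IsIntegral Γ(X, W.opens) t := by
  constructor
  · rintro ⟨p, hp, h⟩
    refine ⟨p.map W.sectionsEquiv.symm.toRingHom, hp.map _, ?_⟩
    rw [Polynomial.eval₂_map]
    convert h
    ext r
    obtain ⟨s, rfl⟩ := W.sectionsEquiv.surjective r
    change X.germToFunctionField W.opens (W.sectionsEquiv.symm (W.sectionsEquiv s)) = _
    rw [RingEquiv.symm_apply_apply]
    rfl
  · rintro ⟨p, hp, h⟩
    refine ⟨p.map W.sectionsEquiv.toRingHom, hp.map _, ?_⟩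
    rw [Polynomial.eval₂_map]
    exact h

lemma isIntegral_iff_of_isBasic {W W' : AffinePatch X} {f : X.functionField}
    (h : W.IsBasic W' f) (t : X.functionField) :
    _root_.IsIntegral W'.functions t ↔ ∃ n : ℕ, _root_.IsIntegral W.functions (f ^ n * t) := by
  have hle := AffinePatch.functions_mono h.le
  have mono {s : X.functionField} (hs : _root_.IsIntegral W.functions s) :
      _root_.IsIntegral W'.functions s := by
    obtain ⟨p, hp, hps⟩ := hs
    refine ⟨p.map (Subring.inclusion hle), hp.map _, ?_⟩
    rw [Polynomial.eval₂_map]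
    exact hps
  constructor
  · intro ht
    let f' : W.functions := ⟨f, h.mem⟩
    let := (Subring.inclusion hle).toAlgebra
    have : IsScalarTower W.functions W'.functions X.functionField := .of_algebraMap_eq fun r => rfl
    have : IsLocalization (Submonoid.powers f') W'.functions :=
      { map_units := by
          rintro ⟨_, n, rfl⟩
          rw [map_pow]
          refine IsUnit.pow n (IsUnit.of_mul_eq_one ⟨f⁻¹, h.inv_mem⟩ (Subtype.ext ?_))
          exact mul_inv_cancel₀ h.ne_zero
        surj := fun k => by
          obtain ⟨n, hn⟩ := (h.mem_functions_iff _).1 k.2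
          refine ⟨⟨⟨_, hn⟩, ⟨_, n, rfl⟩⟩, Subtype.ext ?_⟩
          exact mul_comm _ _
        exists_of_eq := fun {x y} hxy => ⟨1, by
          have : x = y := Subtype.ext (congrArg (Subtype.val : W'.functions → _) hxy)
          rw [this]⟩ }
    obtain ⟨⟨_, n, rfl⟩, hm⟩ :=
      IsIntegral.exists_multiple_integral_of_isLocalization (Submonoid.powers f') t ht
    exact ⟨n, hm⟩
  · rintro ⟨n, hn⟩
    have h1 := (isIntegral_algebraMap (R := W'.functions) (A := X.functionField)
      (x := ⟨_, pow_mem h.inv_mem n⟩)).mul (mono hn)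
    rwa [AffinePatch.algebraMap_functions, ← mul_assoc, ← mul_pow, inv_mul_cancel₀ h.ne_zero,
      one_pow, one_mul] at h1

/-- The normalization of `X` as a lattice sheaf in the function field. -/
noncomputable def normalization (hX : HasFiniteNormalization X) :
    LatticeSheaf X X.functionField where
  sec W := Subalgebra.toSubmodule (integralClosure W.functions X.functionField)
  mem_iff_of_isBasic h t := isIntegral_iff_of_isBasic h t
  fg W := by
    have := hX W.opens W.isAffine
    obtain ⟨S, hS⟩ := Module.Finite.iff_fg (N := Subalgebra.toSubmodule
      (integralClosure Γ(X, W.opens) X.functionField)) |>.1 this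
    refine ⟨S, le_antisymm (Submodule.span_le.2 fun t ht => ?_) fun t ht => ?_⟩
    · exact isIntegral_functions_iff.2 (hS.le (Submodule.subset_span ht))
    · replace ht : t ∈ Submodule.span Γ(X, W.opens) (S : Set X.functionField) :=
        hS.ge (isIntegral_functions_iff.1 ht)
      induction ht using Submodule.span_induction with
      | mem t ht => exact Submodule.subset_span ht
      | zero => exact zero_mem _
      | add t s _ _ ht hs => exact add_mem ht hs
      | smul r t _ ht =>
        rw [Algebra.smul_def]
        exact Submodule.smul_mem _ (W.sectionsEquiv r) ht
  span_eq_top W := by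
    rw [eq_top_iff, ← Ideal.span_singleton_one, Ideal.span, Submodule.span_le]
    exact Set.singleton_subset_iff.2 (Submodule.subset_span (one_mem (integralClosure _ _)))

/-- The normalization as an order in the function field. -/
noncomputable def normalizationOrder (hX : HasFiniteNormalization X) :
    SchemeOrder X X.functionField :=
  (normalization hX).toOrder (fun _ => isIntegral_one) fun _ _ ha _ hb => IsIntegral.mul ha hb

lemma normalizationOrder_isMaximal (hX : HasFiniteNormalization X) :
    (normalizationOrder hX).IsMaximal := by
  refine SchemeOrder.isMaximal_of_forall_affine fun Λ' h W t ht => mem_sections_toOrder.2 ?_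
  refine SchemeOrder.isIntegral_of_smul_mem ((ofOrder Λ').fg W) (v := 1) ?_ one_ne_zero ?_
  · exact one_mem (Λ'.sections W.opens)
  · intro w hw
    exact mul_mem (S := Subring X.functionField) ht hw

/-- If the normalization is an Azumaya order, then `X` is normal. -/
lemma mem_functions_of_isIntegral {hX : HasFiniteNormalization X}
    (h : (normalizationOrder hX).IsAzumaya) {W : AffinePatch X} {t : X.functionField}
    (ht : _root_.IsIntegral W.functions t) : t ∈ W.functions := by
  have := SchemeOrder.isAzumaya_iff.1 h W
  obtain ⟨r, hr⟩ := IsAzumaya.algebraMap_surjective_of_comm (R := W.functions)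
    (A := (normalizationOrder hX).sections W.opens) ⟨t, mem_sections_toOrder.2 ht⟩
  have h1 := congrArg Subtype.val hr
  rw [SchemeOrder.coe_algebraMap] at h1
  have h2 : (r : X.functionField) = t := h1
  rw [← h2]
  exact r.2

end Normalization

end

/-! ### Endomorphism orders of relation lattices -/

section

variable {X : Scheme.{u}} [IsIntegral X]

open LatticeSheaf

section RelationLattice

variable {n : ℕ} (h : Fin n → X.functionField)

/-- The coordinate functions on `Kⁿ`, together with the linear form with coefficients `h`. -/
noncomputable def relationForm :
    Option (Fin n) → (Fin n → X.functionField) →ₗ[X.functionField] X.functionField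
  | none => Fintype.linearCombination X.functionField h
  | some i => LinearMap.proj i

lemma relationForm_none (v : Fin n → X.functionField) :
    relationForm h none v = ∑ i, v i * h i := by
  simp [relationForm, Fintype.linearCombination_apply]

@[simp]
lemma relationForm_some (i : Fin n) (v : Fin n → X.functionField) :
    relationForm h (some i) v = v i := rfl

/-- The products `t • φ v` of a scalar `t` and the values of the forms `φ` of `relationForm h`. -/
noncomputable def relationPairing : (Fin n → X.functionField) →ₗ[X.functionField]
    X.functionField →ₗ[X.functionField] (Option (Fin n) → X.functionField) :=
  LinearMap.mk₂ X.functionField (fun v t o => t * relationForm h o v)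
    (fun v v' t => by ext o; simp [mul_add]) (fun k v t => by ext o; simp [mul_left_comm])
    (fun v t t' => by ext o; simp [add_mul]) (fun k v t => by ext o; simp [mul_assoc])

lemma relationPairing_injective : Function.Injective (relationPairing h) := by
  intro v v' hv
  ext i
  simpa [relationPairing] using congrFun (LinearMap.congr_fun hv 1) (some i)

variable [IsLocallyNoetherian X]

/-- The lattice of all `v` in `𝒪ⁿ` such that `∑ vᵢ hᵢ` is a section of `𝒪`. -/
noncomputable def relationLattice : LatticeSheaf X (Fin n → X.functionField) :=
  colon (relationPairing h) (relationPairing_injective h) structureSheaf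
    (structureSheaf.pi (Option (Fin n)))

lemma mem_sec_relationLattice {W : AffinePatch X} {v : Fin n → X.functionField} :
    v ∈ (relationLattice h).sec W ↔ ∀ o, relationForm h o v ∈ W.functions := by
  simp only [relationLattice, mem_sec_colon, mem_sec_structureSheaf, mem_sec_pi]
  constructor
  · intro hv o
    simpa [relationPairing] using hv 1 (one_mem _) o
  · intro hv t ht o
    exact mul_mem ht (hv o)

/-- The lattice of endomorphisms of `relationLattice h`. -/
noncomputable def relationEnd : LatticeSheaf X (Matrix (Fin n) (Fin n) X.functionField) :=
  colon (Matrix.toLin' (R := X.functionField) (m := Fin n) (n := Fin n)).toLinearMap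
    Matrix.toLin'.injective (relationLattice h) (relationLattice h)

/-- The endomorphism order of `relationLattice h`. -/
noncomputable def relationOrder : SchemeOrder X (Matrix (Fin n) (Fin n) X.functionField) :=
  (relationEnd h).toOrder (fun W v hv => by simpa using hv) fun W a ha b hb v hv => by
    have := ha _ (hb v hv)
    simpa using this

lemma mem_sections_relationOrder {W : AffinePatch X}
    {M : Matrix (Fin n) (Fin n) X.functionField} :
    M ∈ (relationOrder h).sections W.opens ↔
      ∀ v ∈ (relationLattice h).sec W, M.mulVec v ∈ (relationLattice h).sec W :=
  mem_sections_toOrder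

variable {h} {i₀ : Fin n} (h₀ : h i₀ = 0)
include h₀

/-- As `h i₀ = 0`, the `i₀`-th unit vector spans a direct factor of the lattice. -/
lemma smul_single_mem_relationLattice {W : AffinePatch X} {t : X.functionField}
    (ht : t ∈ W.functions) : t • Pi.single i₀ 1 ∈ (relationLattice h).sec W := by
  rw [mem_sec_relationLattice]
  rintro (_ | i)
  · rw [relationForm_none, Finset.sum_eq_zero]
    · exact zero_mem _
    · intro i _
      rcases eq_or_ne i i₀ with rfl | hi
      · rw [h₀, mul_zero]
      · simp [Pi.single_eq_of_ne hi]
  · rcases eq_or_ne i i₀ with rfl | hi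
    · simpa using ht
    · simp [Pi.single_eq_of_ne hi]

omit [IsLocallyNoetherian X] h₀ in
lemma vecMulVec_single_mulVec (u v : Fin n → X.functionField) :
    (Matrix.vecMulVec u (Pi.single i₀ 1)).mulVec v = v i₀ • u := by
  ext i
  simp [Matrix.mulVec, dotProduct, Matrix.vecMulVec_apply, Pi.single_apply, mul_comm]

omit h₀ in
lemma vecMulVec_single_mem_relationOrder {W : AffinePatch X} {u : Fin n → X.functionField}
    (hu : u ∈ (relationLattice h).sec W) :
    Matrix.vecMulVec u (Pi.single i₀ 1) ∈ (relationOrder h).sections W.opens := by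
  rw [mem_sections_relationOrder]
  intro v hv
  rw [vecMulVec_single_mulVec]
  exact (relationLattice h).smul_mem ((mem_sec_relationLattice h).1 hv (some i₀)) hu

/-- For `φ` in a larger order, `u` in the lattice and a coordinate form `f` of `relationForm`, the
multiple of the matrix unit at `(i₀, i₀)` by `f (φ u)` lies in the larger order. So `f (φ u)` is
integral over `X`, hence a function on the normal scheme `X`, and `φ` preserves the lattice. -/
lemma relationOrder_isMaximal
    (hX : ∀ (W : AffinePatch X) (t : X.functionField),
      _root_.IsIntegral W.functions t → t ∈ W.functions) : (relationOrder h).IsMaximal := by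
  refine SchemeOrder.isMaximal_of_forall_affine fun Λ' hΛ' W M hM =>
    (mem_sections_relationOrder h).2 fun u hu => (mem_sec_relationLattice h).2 fun o => ?_
  set t := relationForm h o (M.mulVec u) with ht
  refine hX W t ?_
  let E : Matrix (Fin n) (Fin n) X.functionField :=
    Matrix.vecMulVec (Pi.single i₀ 1) (Pi.single i₀ 1)
  have hE : E ≠ 0 := fun h0 => by
    simpa [E, Matrix.vecMulVec_apply] using congrFun (congrFun h0 i₀) i₀
  have hEE : E * E = E := by
    simp [E, Matrix.vecMulVec_mul_vecMulVec]
  -- `P` is the form `relationForm h o`, followed by the embedding of the `i₀`-th factor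
  let P : Matrix (Fin n) (Fin n) X.functionField :=
    LinearMap.toMatrix' ((relationForm h o).smulRight (Pi.single i₀ (1 : X.functionField)))
  have hP (v : Fin n → X.functionField) : P.mulVec v = relationForm h o v • Pi.single i₀ 1 := by
    simp [P, LinearMap.toMatrix'_mulVec]
  have hPmem : P ∈ Λ'.sections W.opens := hΛ' W.opens <| by
    rw [mem_sections_relationOrder]
    intro v hv
    rw [hP]
    exact smul_single_mem_relationLattice h₀ ((mem_sec_relationLattice h).1 hv o)
  have hQmem := hΛ' W.opens (vecMulVec_single_mem_relationOrder (i₀ := i₀) hu)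
  have htE : t • E = P * M * Matrix.vecMulVec u (Pi.single i₀ 1) := by
    rw [Matrix.mul_vecMulVec, ← Matrix.mulVec_mulVec, hP, Matrix.smul_vecMulVec]
  have hmem : t • E ∈ Λ'.sections W.opens := by
    rw [htE]
    exact mul_mem (mul_mem hPmem hM) hQmem
  refine SchemeOrder.isIntegral_of_smul_mem
    (N := ((ofOrder Λ').sec W).map (LinearMap.mulRight W.functions E))
    (((ofOrder Λ').fg W).map _) (v := E) ⟨1, one_mem (Λ'.sections W.opens), by simp⟩ hE ?_
  rintro _ ⟨a, ha, rfl⟩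
  refine ⟨a * (t • E), mul_mem (S := Subring (Matrix (Fin n) (Fin n) X.functionField)) ha hmem, ?_⟩
  simp [mul_assoc, hEE]

/-- The lattice is a direct factor of its endomorphism order, via `u ↦ u e₀ᵗ` and `φ ↦ φ e₀`. -/
lemma projective_relationLattice {W : AffinePatch X}
    [Module.Projective W.functions ((relationOrder h).sections W.opens)] :
    Module.Projective W.functions ((relationLattice h).sec W) := by
  have he : Pi.single i₀ 1 ∈ (relationLattice h).sec W := by
    simpa using smul_single_mem_relationLattice h₀ (one_mem W.functions)
  let s : (relationLattice h).sec W →ₗ[W.functions] (relationOrder h).sections W.opens :=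
    { toFun := fun u => ⟨_, vecMulVec_single_mem_relationOrder (i₀ := i₀) u.2⟩
      map_add' := fun u v => Subtype.ext (Matrix.add_vecMulVec (u : Fin n → X.functionField) v _)
      map_smul' := fun r u => Subtype.ext (by
        rw [RingHom.id_apply, SchemeOrder.coe_smul]
        exact Matrix.smul_vecMulVec (r : X.functionField) (u : Fin n → X.functionField) _) }
  let r : (relationOrder h).sections W.opens →ₗ[W.functions] (relationLattice h).sec W :=
    { toFun := fun M => ⟨_, (mem_sections_relationOrder h).1 M.2 _ he⟩
      map_add' := fun M N => Subtype.ext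
        (Matrix.add_mulVec (M : Matrix (Fin n) (Fin n) X.functionField) N _)
      map_smul' := fun r M => Subtype.ext (by
        rw [RingHom.id_apply]
        change ((r • M : (relationOrder h).sections W.opens) :
          Matrix (Fin n) (Fin n) X.functionField).mulVec _ = _
        rw [SchemeOrder.coe_smul]
        exact Matrix.smul_mulVec (r : X.functionField)
          (M : Matrix (Fin n) (Fin n) X.functionField) _) }
  refine Module.Projective.of_split s r (LinearMap.ext fun u => Subtype.ext ?_)
  change (Matrix.vecMulVec (u : Fin n → X.functionField) (Pi.single i₀ 1)).mulVec
    (Pi.single i₀ 1) = u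
  rw [vecMulVec_single_mulVec, Pi.single_eq_same, one_smul]

end RelationLattice

/-- The forms in `relationForm h` as linear maps from the sections of `relationLattice h` to the
functions. -/
noncomputable def relationFormSec [IsLocallyNoetherian X] {n : ℕ} (h : Fin n → X.functionField)
    (W : AffinePatch X) (o : Option (Fin n)) :
    (relationLattice h).sec W →ₗ[W.functions] W.functions where
  toFun v := ⟨relationForm h o v, (mem_sec_relationLattice h).1 v.2 o⟩
  map_add' v w := Subtype.ext (map_add (relationForm h o) (v : Fin n → X.functionField) w)
  map_smul' r v := Subtype.ext
    (map_smul (relationForm h o) (r : X.functionField) (v : Fin n → X.functionField))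

/-- The linear map replacing the `i₀`-th coordinate of a tuple of functions by zero. -/
noncomputable def dropCoordinate (W : AffinePatch X) {n : ℕ} (i₀ : Fin n) :
    (Fin n → W.functions) →ₗ[W.functions] (Fin n → X.functionField) :=
  LinearMap.pi fun i =>
    if i = i₀ then 0 else (Algebra.linearMap W.functions X.functionField).comp (LinearMap.proj i)

lemma dropCoordinate_self {W : AffinePatch X} {n : ℕ} (i₀ : Fin n) (c : Fin n → W.functions) :
    dropCoordinate W i₀ c i₀ = 0 := by
  simp [dropCoordinate]

lemma dropCoordinate_of_ne {W : AffinePatch X} {n : ℕ} (i₀ : Fin n) (c : Fin n → W.functions)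
    {i : Fin n} (hi : i ≠ i₀) : dropCoordinate W i₀ c i = c i := by
  simp [dropCoordinate, hi]

/-- The relations between functions `a i` on `W` with `a i₀ ≠ 0` are a direct factor of the lattice
`relationLattice h` with `h i = a i / a i₀` for `i ≠ i₀`. -/
lemma projective_relations_of_relationLattice [IsLocallyNoetherian X] {W : AffinePatch X} {n : ℕ}
    (a : Fin n → W.functions) {i₀ : Fin n} (ha : a i₀ ≠ 0)
    [Module.Projective W.functions ((relationLattice (Function.update
      (fun i => (a i : X.functionField) / (a i₀ : X.functionField)) i₀ 0)).sec W)] :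
    Module.Projective W.functions (LinearMap.ker (Fintype.linearCombination W.functions a)) := by
  set h : Fin n → X.functionField := Function.update
    (fun i => (a i : X.functionField) / (a i₀ : X.functionField)) i₀ 0 with hh
  have ha' : (a i₀ : X.functionField) ≠ 0 := fun h => ha (Subtype.ext h)
  have hform (v : Fin n → X.functionField) :
      (a i₀ : X.functionField) * relationForm h none v = ∑ i, v i * a i - v i₀ * a i₀ := by
    have h1 := Finset.sum_erase_add _ (fun i => v i * (a i : X.functionField)) (Finset.mem_univ i₀)
    rw [relationForm_none, ← Finset.sum_erase_add _ _ (Finset.mem_univ i₀), ← h1,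
      hh, Function.update_self, mul_zero, add_zero, add_sub_cancel_right, Finset.mul_sum]
    refine Finset.sum_congr rfl fun i hi => ?_
    rw [Function.update_of_ne (Finset.ne_of_mem_erase hi)]
    field_simp
  have hker (c : Fin n → W.functions) :
      c ∈ LinearMap.ker (Fintype.linearCombination W.functions a) ↔
        ∑ i, (c i : X.functionField) * a i = 0 := by
    rw [LinearMap.mem_ker, Fintype.linearCombination_apply, ← Subtype.coe_inj]
    simp
  -- the component at `i₀` of a relation is determined by the others
  have hform' {c : Fin n → W.functions}
      (hc : c ∈ LinearMap.ker (Fintype.linearCombination W.functions a)) :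
      relationForm h none (dropCoordinate W i₀ c) = -c i₀ := by
    have h1 := Finset.sum_erase_add _ (fun i => (c i : X.functionField) * (a i : X.functionField))
      (Finset.mem_univ i₀)
    rw [(hker c).1 hc] at h1
    refine mul_left_cancel₀ ha' ?_
    rw [hform, dropCoordinate_self, ← Finset.sum_erase_add _ _ (Finset.mem_univ i₀),
      dropCoordinate_self, Finset.sum_congr rfl fun i hi => by
        rw [dropCoordinate_of_ne _ _ (Finset.ne_of_mem_erase hi)]]
    linear_combination h1
  have hs (c : LinearMap.ker (Fintype.linearCombination W.functions a)) :
      dropCoordinate W i₀ c ∈ (relationLattice h).sec W := by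
    rw [mem_sec_relationLattice]
    rintro (_ | i)
    · rw [hform' c.2]
      exact neg_mem (c.1 i₀).2
    · rw [relationForm_some]
      rcases eq_or_ne i i₀ with rfl | hi
      · rw [dropCoordinate_self]
        exact zero_mem _
      · rw [dropCoordinate_of_ne _ _ hi]
        exact (c.1 i).2
  let s : LinearMap.ker (Fintype.linearCombination W.functions a) →ₗ[W.functions]
      (relationLattice h).sec W :=
    ((dropCoordinate W i₀).comp (Submodule.subtype _)).codRestrict _ hs
  let q : (relationLattice h).sec W →ₗ[W.functions] (Fin n → W.functions) :=
    LinearMap.pi fun i => if i = i₀ then -relationFormSec h W none else relationFormSec h W (some i)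
  have hq₀ (v : (relationLattice h).sec W) :
      (q v i₀ : X.functionField) = -relationForm h none v := by
    change ((if i₀ = i₀ then -relationFormSec h W none else _ : _ →ₗ[W.functions] _) v :
      X.functionField) = _
    rw [if_pos rfl]
    rfl
  have hq (v : (relationLattice h).sec W) {i : Fin n} (hi : i ≠ i₀) :
      (q v i : X.functionField) = v.1 i := by
    change ((if i = i₀ then -relationFormSec h W none else relationFormSec h W (some i) :
      _ →ₗ[W.functions] _) v : X.functionField) = _
    rw [if_neg hi]
    rfl
  have hqker (v : (relationLattice h).sec W) :
      q v ∈ LinearMap.ker (Fintype.linearCombination W.functions a) := by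
    have h1 := Finset.sum_erase_add _ (fun i => v.1 i * (a i : X.functionField))
      (Finset.mem_univ i₀)
    have h2 := hform v
    rw [hker, ← Finset.sum_erase_add _ _ (Finset.mem_univ i₀), hq₀, Finset.sum_congr rfl fun i hi =>
      by rw [hq v (Finset.ne_of_mem_erase hi)]]
    linear_combination h1 - h2
  refine Module.Projective.of_split s (q.codRestrict _ hqker)
    (LinearMap.ext fun c => Subtype.ext (funext fun i => Subtype.ext ?_))
  change (q (s c) i : X.functionField) = c.1 i
  rcases eq_or_ne i i₀ with rfl | hi
  · rw [hq₀]
    change -relationForm h none (dropCoordinate W _ c) = _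
    rw [hform' c.2, neg_neg]
  · rw [hq _ hi]
    exact dropCoordinate_of_ne _ _ hi

/-- If all maximal orders in the matrix algebras over `K` are Azumaya, then the localizations of
the rings of functions of a normal scheme of dimension at most two are regular. -/
lemma isRegularLocalRing_localization_of_normal [IsLocallyNoetherian X]
    (hdim : topologicalKrullDim X ≤ 2)
    (hX : ∀ (W : AffinePatch X) (t : X.functionField),
      _root_.IsIntegral W.functions t → t ∈ W.functions)
    (hA : ∀ (n : ℕ) [NeZero n] (Λ : SchemeOrder X (Matrix (Fin n) (Fin n) X.functionField)),
      Λ.IsMaximal → Λ.IsAzumaya)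
    (W : AffinePatch X) (p : Ideal W.functions) [p.IsPrime] :
    IsRegularLocalRing (Localization.AtPrime p) := by
  have : IsIntegrallyClosed W.functions := by
    rw [isIntegrallyClosed_iff X.functionField]
    exact fun {t} ht => ⟨⟨t, hX W t ht⟩, rfl⟩
  have hp := p.primeCompl_le_nonZeroDivisors
  have : IsIntegrallyClosed (Localization.AtPrime p) :=
    isIntegrallyClosed_of_isLocalization _ p.primeCompl hp
  refine IsRegularLocalRing.of_projective_relations ?_ fun n g _ _ => ?_
  · rw [IsLocalization.AtPrime.ringKrullDim_eq_height p]
    exact (Ideal.height_le_ringKrullDim_of_ne_top Ideal.IsPrime.ne_top').trans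
      (W.ringKrullDim_functions_le.trans hdim)
  by_cases hg : g = 0
  · have : LinearMap.ker (Fintype.linearCombination (Localization.AtPrime p) g) = ⊤ := by
      rw [eq_top_iff]
      intro c _
      simp [hg, Fintype.linearCombination_apply]
    rw [this]
    exact Module.Projective.of_equiv Submodule.topEquiv.symm
  obtain ⟨i₀, hi₀⟩ := Function.ne_iff.1 hg
  obtain ⟨m, hm⟩ := IsLocalization.exist_integer_multiples_of_finite p.primeCompl g
  choose a ha using hm
  have hunit := IsLocalization.map_units (Localization.AtPrime p) m
  have ha' : ∀ i, algebraMap _ (Localization.AtPrime p) (a i) =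
      algebraMap _ (Localization.AtPrime p) (m : W.functions) * g i := fun i => by
    rw [ha, Algebra.smul_def]
  have hai₀ : a i₀ ≠ 0 := fun h0 => by
    have := ha' i₀
    rw [h0, map_zero, eq_comm, hunit.mul_right_eq_zero] at this
    exact hi₀ this
  have : NeZero n := ⟨fun h => by subst h; exact i₀.elim0⟩
  set h : Fin n → X.functionField := Function.update
    (fun i => (a i : X.functionField) / (a i₀ : X.functionField)) i₀ 0 with hh
  have h₀ : h i₀ = 0 := Function.update_self _ _ _
  have := SchemeOrder.isAzumaya_iff.1 (hA n _ (relationOrder_isMaximal h₀ hX)) W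
  have := projective_relationLattice h₀ (W := W)
  have := projective_relations_of_relationLattice a hai₀
  exact Module.projective_relations_of_isLocalization p.primeCompl hp a g _ hunit ha'

/-- If all maximal orders in algebras with unramified Brauer class are Azumaya, then `X` is
regular. -/
theorem isRegularScheme_of_forall_isAzumaya [IsLocallyNoetherian X]
    (hdim : topologicalKrullDim X ≤ 2) (hnorm : HasFiniteNormalization X)
    (h : ∀ A : CSA.{u, u} X.functionField, HasUnramifiedBrauerClass X A →
      ∀ Λ : SchemeOrder X A, Λ.IsMaximal → Λ.IsAzumaya) : IsRegularScheme X := by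
  intro x
  obtain ⟨W, hW⟩ := AffinePatch.exists_mem x
  obtain ⟨p, _, _, _⟩ := W.exists_isLocalization_stalk hW
  have := isRegularLocalRing_localization_of_normal hdim
    (fun W t ht => mem_functions_of_isIntegral
      (h _ hasUnramifiedBrauerClass_trivialCSA _ (normalizationOrder_isMaximal hnorm)) ht)
    (fun n _ Λ hΛ => h _ (hasUnramifiedBrauerClass_matrixCSA n) Λ hΛ) W p
  exact IsRegularLocalRing.of_ringEquiv (IsLocalization.algEquiv p.primeCompl
    (Localization.AtPrime p) (X.presheaf.stalk x)).toRingEquiv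

end

/-- A two-dimensional integral noetherian scheme with finite normalization is regular if and only if
every maximal order over it in a central simple algebra over its function field with unramified
Brauer class is Azumaya. -/
theorem theorem2 (X : Scheme.{u}) [IsIntegral X] [IsNoetherian X]
    (hdim : topologicalKrullDim X = 2) (hnorm : HasFiniteNormalization X) :
    IsRegularScheme X ↔
      ∀ A : CSA.{u, u} X.functionField, HasUnramifiedBrauerClass X A →
        ∀ Λ : SchemeOrder X A, Λ.IsMaximal → Λ.IsAzumaya :=
  ⟨fun hX _ hA _ hΛ => isAzumaya_of_hasUnramifiedBrauerClass hX hdim.le hA hΛ,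
    isRegularScheme_of_forall_isAzumaya hdim.le hnorm⟩
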